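/- Conventions. A quantum set $\mathcal X$ is a family $(X_\alpha)_\alpha$ of nonzero finite-dimensional complex Hilbert spaces (its atoms), and $\ell^\infty(\mathcal X)=\{(a_\alpha)_\alpha : a_\alpha\in L(X_\alpha),\ \sup_\alpha\|a_\alpha\|<\infty\}$. The dual $\mathcal X^*$ has atoms $X_\alpha^*$, the product $\mathcal X\times\mathcal Y$ has atoms $X_\alpha\otimes Y_\beta$, and $\mathbf 1$ has the single atom $\mathbb C$. One identifies $\ell^\infty(\mathcal X)\mathbin{\overline\otimes}\ell^\infty(\mathcal Y)=\ell^\infty(\mathcal X\times\mathcal Y)$, $\ell^\infty(\mathcal X)^{op}=\ell^\infty(\mathcal X^*)$ (through transposition on each factor), $\ell^\infty(\mathbf 1)=\mathbb C$ and $\mathcal X^{**}=\mathcal X$. A $W^*$-morphism is a unital normal $*$-homomorphism. A relation $R:\mathcal X\to\mathcal Y$ (a morphism of $\mathbf{qRel}$) is a choice of subspaces $R(X_\alpha,Y_\beta)\le L(X_\alpha,Y_\beta)$. Relations are ordered by inclusion; composition is $(S\circ R)(X_\alpha,Z_\gamma)=\mathrm{span}\bigcup_\beta S(Y_\beta,Z_\gamma)R(X_\alpha,Y_\beta)$,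 the dagger is $R^\dagger(Y_\beta,X_\alpha)=\{r^*: r\in R(X_\alpha,Y_\beta)\}$, and $R\times S$ is spanned by the operators $r\otimes s$. A $W^*$-morphism $\psi:\ell^\infty(\mathcal Y)\to\ell^\infty(\mathcal X)$ gives the relation $\hat\psi:\mathcal X\to\mathcal Y$, $\hat\psi(X_\alpha,Y_\beta)=\{T : a_\beta T=T\,\psi(a)_\alpha\ \ \forall a\in\ell^\infty(\mathcal Y)\}$. The evaluation $\mathrm{ev}_{\mathcal X}:\mathcal X^*\times\mathcal X\to\mathbf 1$ is spanned on $X_\alpha^*\otimes X_\alpha$ by the functional $f\otimes x\mapsto f(x)$ and is zero on $X_\alpha^*\otimes X_\beta$ for $\alpha\ne\beta$; similarly $\mathrm{ev}_{\mathcal X^*}:\mathcal X\times\mathcal X^*\to\mathbf 1$, with $x\otimes f\mapsto f(x)$. For a von Neumann algebra $N$, a diagonal state on $N\mathbin{\overline\otimes}N^{op}$ is a normal state $\varphi$ with $\varphi(p\otimes(1-p))=0$ for every projection $p\in N$. Statement. Let $(M,\Delta,\varepsilon)$ be a discrete quantum monoid with $M=\ell^\infty(\mathcal X)$, that is, $\Delta:M\to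 M\mathbin{\overline\otimes}M$ and $\varepsilon:M\to\mathbb C$ are $W^*$-morphisms such that $(\Delta\mathbin{\overline\otimes}\mathrm{id})\Delta=(\mathrm{id}\mathbin{\overline\otimes}\Delta)\Delta$ and $(\varepsilon\mathbin{\overline\otimes}\mathrm{id})\Delta=\mathrm{id}=(\mathrm{id}\mathbin{\overline\otimes}\varepsilon)\Delta$. Let $s:M\to M^{op}$ be a $W^*$-morphism. Consider the conditions (1) $\varphi\circ(s\mathbin{\overline\otimes}\mathrm{id})\circ\Delta=\varepsilon$ for all diagonal states $\varphi$ on $M^{op}\mathbin{\overline\otimes}M$; (2) $\varphi\circ(\mathrm{id}\mathbin{\overline\otimes}s)\circ\Delta=\varepsilon$ for all diagonal states $\varphi$ on $M\mathbin{\overline\otimes}M^{op}$. Then (1) is equivalent to $\hat\varepsilon^\dagger\circ\hat\Delta\circ(\hat s\times\mathrm{id})\ge\mathrm{ev}_{\mathcal X}$, and (2) is equivalent to $\hat\varepsilon^\dagger\circ\hat\Delta\circ(\mathrm{id}\times\hat s)\ge\mathrm{ev}_{\mathcal X^*}$. Moreover (1) is equivalent to the equality $\hat\Delta\circ(\hat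 s\times\mathrm{id})\circ\mathrm{ev}_{\mathcal X}^\dagger=\hat\varepsilon$, and (2) is equivalent to the equality $\hat\Delta\circ(\mathrm{id}\times\hat s)\circ\mathrm{ev}_{\mathcal X^*}^\dagger=\hat\varepsilon$. With $m=\hat\Delta$, $e=\hat\varepsilon$, $i=\hat s$ and the cups being the daggers of the evaluations, these two equalities are what the two inversion diagrams for $i$ say in $\mathbf{qRel}$. -/

import Mathlib

open scoped ENNReal TensorProduct InnerProductSpace ComplexOrder

universe u v u' v' u'' v'' u₁ v₁

noncomputable section

/-! ### Quantum sets -/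

/-- The dual of a Hilbert space is a Hilbert space for the operator norm: its inner product is the
one that makes the Riesz map `E → E*` antiunitary. -/
@[reducible] def dualInnerProductSpace (E : Type*) [NormedAddCommGroup E]
    [InnerProductSpace ℂ E] [CompleteSpace E] : InnerProductSpace ℂ (StrongDual ℂ E) where
  inner f g := ⟪(InnerProductSpace.toDual ℂ E).symm g, (InnerProductSpace.toDual ℂ E).symm f⟫_ℂ
  norm_sq_eq_re_inner f := by
    rw [inner_self_eq_norm_sq, LinearIsometryEquiv.norm_map]
  conj_inner_symm f g := inner_conj_symm _ _
  add_left f g h := by rw [map_add, inner_add_right]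
  smul_left f g r := by rw [map_smulₛₗ, inner_smul_right]

set_option linter.checkUnivs false in
/-- A quantum set: a family of nonzero finite-dimensional Hilbert spaces, called its atoms. -/
structure QuantumSet where
  /-- the index set of the family of atoms -/
  At : Type v
  /-- the atoms -/
  space : At → Type u
  [normedSpace : ∀ i, NormedAddCommGroup (space i)]
  [innerSpace : ∀ i, InnerProductSpace ℂ (space i)]
  [finiteDim : ∀ i, FiniteDimensional ℂ (space i)]
  [nontriv : ∀ i, Nontrivial (space i)]

namespace QuantumSet

attribute [instance] normedSpace innerSpace finiteDim nontriv

instance completeSpace (X : QuantumSet.{u, v}) (i : X.At) : CompleteSpace (X.space i) :=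
  FiniteDimensional.complete ℂ _

/-- The monoidal unit: the quantum set with the single atom `ℂ`. -/
def one : QuantumSet.{0, 0} where
  At := Unit
  space _ := ℂ

/-- The dual quantum set `X*`, whose atoms are the dual Hilbert spaces of the atoms of `X`. -/
def dual (X : QuantumSet.{u, v}) : QuantumSet.{u, v} where
  At := X.At
  space i := StrongDual ℂ (X.space i)
  innerSpace i := dualInnerProductSpace (X.space i)
  finiteDim _ := inferInstance
  nontriv i := (InnerProductSpace.toDual ℂ (X.space i)).injective.nontrivial

/-- The product `X × Y`, whose atoms are the tensor products of an atom of `X` and one of `Y`. -/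
def prod (X : QuantumSet.{u, v}) (Y : QuantumSet.{u', v'}) :
    QuantumSet.{max u u', max v v'} where
  At := X.At × Y.At
  space p := X.space p.1 ⊗[ℂ] Y.space p.2

end QuantumSet

/-- The hereditarily atomic von Neumann algebra `ℓ^∞(X)`: the bounded families in `∏ L(X_i)`, with
entrywise operations. For quantum sets `X`, `Y` the von Neumann tensor product
`ℓ^∞(X) ⊗̄ ℓ^∞(Y)` is `ℓ^∞(X × Y)`. -/
def LInf (X : QuantumSet.{u, v}) : Type (max u v) :=
  lp (fun i : X.At => X.space i →L[ℂ] X.space i) ∞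

namespace LInf

variable {X : QuantumSet.{u, v}}

instance : CoeFun (LInf X) fun _ => ∀ i : X.At, X.space i →L[ℂ] X.space i := ⟨fun a => a.1⟩

instance (X : QuantumSet.{u, v}) : NormedRing (LInf X) :=
  inferInstanceAs (NormedRing (lp (fun i : X.At => X.space i →L[ℂ] X.space i) ∞))

instance (X : QuantumSet.{u, v}) : StarRing (LInf X) :=
  inferInstanceAs (StarRing (lp (fun i : X.At => X.space i →L[ℂ] X.space i) ∞))

instance (X : QuantumSet.{u, v}) : NormedAlgebra ℂ (LInf X) :=
  inferInstanceAs (NormedAlgebra ℂ (lp (fun i : X.At => X.space i →L[ℂ] X.space i) ∞))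

instance (X : QuantumSet.{u, v}) : CStarAlgebra (LInf X) where
  toCompleteSpace := inferInstanceAs (CompleteSpace (lp (fun i : X.At => X.space i →L[ℂ] X.space i) ∞))
  norm_mul_self_le := (inferInstance : CStarRing (lp (fun i : X.At => X.space i →L[ℂ] X.space i) ∞)).norm_mul_self_le
  star_smul := (inferInstance : StarModule ℂ (lp (fun i : X.At => X.space i →L[ℂ] X.space i) ∞)).star_smul

@[ext] theorem ext {a b : LInf X} (h : ∀ i, a i = b i) : a = b := Subtype.ext (funext h)
@[simp] theorem zero_apply (i : X.At) : (0 : LInf X) i = 0 := rfl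
@[simp] theorem one_apply (i : X.At) : (1 : LInf X) i = 1 := rfl
@[simp] theorem add_apply (a b : LInf X) (i : X.At) : (a + b) i = a i + b i := rfl
@[simp] theorem neg_apply (a : LInf X) (i : X.At) : (-a) i = -a i := rfl
@[simp] theorem sub_apply (a b : LInf X) (i : X.At) : (a - b) i = a i - b i := rfl
@[simp] theorem mul_apply (a b : LInf X) (i : X.At) : (a * b) i = a i * b i := rfl
@[simp] theorem star_apply (a : LInf X) (i : X.At) : (star a) i = star (a i) := rfl
@[simp] theorem smul_apply (c : ℂ) (a : LInf X) (i : X.At) : (c • a) i = c • a i := rfl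

theorem norm_apply_le (a : LInf X) (i : X.At) : ‖a i‖ ≤ ‖a‖ :=
  lp.norm_apply_le_norm (E := fun i : X.At => X.space i →L[ℂ] X.space i) ENNReal.top_ne_zero a i

/-- The element of `ℓ^∞(X)` given by a family bounded by `C`. -/
def mk (a : ∀ i : X.At, X.space i →L[ℂ] X.space i) (C : ℝ) (h : ∀ i, ‖a i‖ ≤ C) : LInf X :=
  ⟨a, memℓp_infty ⟨C, by rintro _ ⟨i, rfl⟩; exact h i⟩⟩

@[simp] theorem mk_apply (a : ∀ i : X.At, X.space i →L[ℂ] X.space i) (C : ℝ)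
    (h : ∀ i, ‖a i‖ ≤ C) (i : X.At) : mk a C h i = a i := rfl

open Classical in
/-- The inclusion `L(X_j) → ℓ^∞(X)` of a factor. -/
def single (j : X.At) (b : X.space j →L[ℂ] X.space j) : LInf X :=
  lp.single (E := fun i : X.At => X.space i →L[ℂ] X.space i) ∞ j b

@[simp] theorem single_self (j : X.At) (b : X.space j →L[ℂ] X.space j) : single j b j = b := by
  classical exact lp.single_apply_self (E := fun i : X.At => X.space i →L[ℂ] X.space i) ∞ j b

theorem single_ne {i j : X.At} (h : i ≠ j) (b : X.space j →L[ℂ] X.space j) :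
    single j b i = 0 := by
  classical exact lp.single_apply_ne (E := fun i : X.At => X.space i →L[ℂ] X.space i) ∞ j b h

theorem ext_single {j : X.At} {a b : LInf X} (h : a j = b j) (h' : ∀ i, i ≠ j → a i = b i) :
    a = b := by
  ext1 i
  by_cases hi : i = j
  · subst hi; exact h
  · exact h' i hi

theorem single_add (j : X.At) (a b : X.space j →L[ℂ] X.space j) :
    single j (a + b) = single j a + single j b :=
  ext_single (j := j) (by simp) fun i hi => by simp [single_ne hi]

theorem single_smul (j : X.At) (c : ℂ) (b : X.space j →L[ℂ] X.space j) :
    single j (c • b) = c • single j b :=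
  ext_single (j := j) (by simp) fun i hi => by simp [single_ne hi]

theorem single_mul (j : X.At) (a b : X.space j →L[ℂ] X.space j) :
    single j (a * b) = single j a * single j b :=
  ext_single (j := j) (by simp) fun i hi => by simp [single_ne hi]

theorem single_star (j : X.At) (a : X.space j →L[ℂ] X.space j) :
    single j (star a) = star (single j a) :=
  ext_single (j := j) (by simp) fun i hi => by simp [single_ne hi]

theorem single_mul_ne {j k : X.At} (h : j ≠ k) (a : X.space j →L[ℂ] X.space j)
    (b : X.space k →L[ℂ] X.space k) : single j a * single k b = 0 :=
  ext_single (j := j) (by simp [single_ne h]) fun i hi => by simp [single_ne hi]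

end LInf

/-! ### Normal maps, `W*`-morphisms, states -/

/-- The order of a von Neumann algebra: `a ≤ b` iff `b - a` is of the form `c* c`. -/
def StarLE {A : Type*} [Ring A] [StarRing A] (a b : A) : Prop :=
  ∃ c : A, b - a = star c * c

/-- `x` is the supremum of the set `D` for the order `StarLE`. -/
def IsStarSup {A : Type*} [Ring A] [StarRing A] (D : Set A) (x : A) : Prop :=
  (∀ d ∈ D, StarLE d x) ∧ ∀ y, (∀ d ∈ D, StarLE d y) → StarLE x y

/-- A map is normal if it preserves the suprema of upward directed sets of self-adjoint
elements. -/
def IsNormalMap {A B : Type*} [Ring A] [StarRing A] [Ring B] [StarRing B] (f : A → B) : Prop :=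
  ∀ (D : Set A) (x : A), D.Nonempty → (∀ d ∈ D, IsSelfAdjoint d) → DirectedOn StarLE D →
    IsStarSup D x → IsStarSup (f '' D) (f x)

/-- A `W*`-morphism: a unital normal `*`-homomorphism. -/
structure WStarHom (A B : Type*) [Ring A] [StarRing A] [Algebra ℂ A] [Ring B] [StarRing B]
    [Algebra ℂ B] extends A →⋆ₐ[ℂ] B where
  normal : IsNormalMap toFun

/-- Normal states on `ℓ^∞(X)`. -/
structure IsNormalState {X : QuantumSet.{u, v}} (φ : LInf X →ₗ[ℂ] ℂ) : Prop where
  nonneg : ∀ a, 0 ≤ φ (star a * a)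
  map_one : φ 1 = 1
  normal : IsNormalMap φ

/-! ### Tensor products -/

/-- The tensor product `S ⊗ T` of operators between atoms, from the atom `X_i ⊗ Y_j` of `X × Y`
to the atom `X'_i' ⊗ Y'_j'` of `X' × Y'`, where `p = (i, j)` and `q = (i', j')`. -/
def opTensor {X : QuantumSet.{u, v}} {Y : QuantumSet.{u', v'}} {X' : QuantumSet.{u'', v''}}
    {Y' : QuantumSet.{u₁, v₁}} {p : (X.prod Y).At} {q : (X'.prod Y').At}
    (S : X.space p.1 →L[ℂ] X'.space q.1) (T : Y.space p.2 →L[ℂ] Y'.space q.2) :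
    (X.prod Y).space p →L[ℂ] (X'.prod Y').space q :=
  TensorProduct.mapL S T

/-- The elementary tensor `a ⊗ b ∈ ℓ^∞(X) ⊗̄ ℓ^∞(Y)`. -/
def LInf.tmul {X : QuantumSet.{u, v}} {Y : QuantumSet.{u', v'}} (a : LInf X) (b : LInf Y) :
    LInf (X.prod Y) :=
  LInf.mk (fun p => opTensor (p := p) (q := p) (a p.1) (b p.2)) (‖a‖ * ‖b‖) fun p =>
    le_trans (TensorProduct.norm_mapL_le (a p.1) (b p.2)) (mul_le_mul
      (a.norm_apply_le p.1) (b.norm_apply_le p.2) (norm_nonneg _) (norm_nonneg _))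

/-- The canonical isomorphism `L(E) ⊗ L(F) ≅ L(E ⊗ F)` for finite-dimensional spaces. -/
def endTensorEquiv (E F : Type*) [NormedAddCommGroup E] [InnerProductSpace ℂ E]
    [FiniteDimensional ℂ E] [NormedAddCommGroup F] [InnerProductSpace ℂ F]
    [FiniteDimensional ℂ F] :
    (E →L[ℂ] E) ⊗[ℂ] (F →L[ℂ] F) ≃ₗ[ℂ] (E ⊗[ℂ] F →L[ℂ] E ⊗[ℂ] F) :=
  (TensorProduct.congr LinearMap.toContinuousLinearMap.symm
    LinearMap.toContinuousLinearMap.symm).trans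
    ((homTensorHomEquiv ℂ E F E F).trans LinearMap.toContinuousLinearMap)

theorem endTensorEquiv_tmul {E F : Type*} [NormedAddCommGroup E] [InnerProductSpace ℂ E]
    [FiniteDimensional ℂ E] [NormedAddCommGroup F] [InnerProductSpace ℂ F]
    [FiniteDimensional ℂ F] (a : E →L[ℂ] E) (b : F →L[ℂ] F) :
    endTensorEquiv E F (a ⊗ₜ b) = TensorProduct.mapL a b := by
  ext x
  simp [endTensorEquiv, homTensorHomEquiv_apply]

section endTensor

variable {E F E' F' : Type*}
  [NormedAddCommGroup E] [InnerProductSpace ℂ E] [FiniteDimensional ℂ E]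
  [NormedAddCommGroup F] [InnerProductSpace ℂ F] [FiniteDimensional ℂ F]
  [NormedAddCommGroup E'] [InnerProductSpace ℂ E'] [FiniteDimensional ℂ E']
  [NormedAddCommGroup F'] [InnerProductSpace ℂ F'] [FiniteDimensional ℂ F']

/-- For linear `f : L(E) → L(E')` and `g : L(F) → L(F')`, the linear map
`L(E ⊗ F) → L(E' ⊗ F')` with `a ⊗ b ↦ f a ⊗ g b`. -/
def endTensor (f : (E →L[ℂ] E) →ₗ[ℂ] (E' →L[ℂ] E')) (g : (F →L[ℂ] F) →ₗ[ℂ] (F' →L[ℂ] F')) :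
    (E ⊗[ℂ] F →L[ℂ] E ⊗[ℂ] F) →ₗ[ℂ] (E' ⊗[ℂ] F' →L[ℂ] E' ⊗[ℂ] F') :=
  (endTensorEquiv E' F').toLinearMap ∘ₗ TensorProduct.map f g ∘ₗ
    (endTensorEquiv E F).symm.toLinearMap

theorem endTensor_mapL (f : (E →L[ℂ] E) →ₗ[ℂ] (E' →L[ℂ] E'))
    (g : (F →L[ℂ] F) →ₗ[ℂ] (F' →L[ℂ] F')) (a : E →L[ℂ] E) (b : F →L[ℂ] F) :
    endTensor f g (TensorProduct.mapL a b) = TensorProduct.mapL (f a) (g b) := by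
  simp [endTensor, ← endTensorEquiv_tmul]

theorem end_tensor_induction {p : (E ⊗[ℂ] F →L[ℂ] E ⊗[ℂ] F) → Prop}
    (x : E ⊗[ℂ] F →L[ℂ] E ⊗[ℂ] F) (h0 : p 0)
    (ht : ∀ a b, p (TensorProduct.mapL a b)) (ha : ∀ x y, p x → p y → p (x + y)) : p x := by
  obtain ⟨t, rfl⟩ := (endTensorEquiv E F).surjective x
  induction t with
  | zero => rw [LinearEquiv.map_zero]; exact h0
  | tmul a b => rw [endTensorEquiv_tmul]; exact ht a b
  | add s t hs ht => rw [LinearEquiv.map_add]; exact ha _ _ hs ht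

theorem endTensor_eq_zero (f : (E →L[ℂ] E) →ₗ[ℂ] (E' →L[ℂ] E'))
    (g : (F →L[ℂ] F) →ₗ[ℂ] (F' →L[ℂ] F')) (h : f = 0 ∨ g = 0) : endTensor f g = 0 := by
  ext1 x
  induction x using end_tensor_induction with
  | h0 => rw [map_zero, map_zero]
  | ha x x' hx hx' => rw [map_add, map_add, hx, hx']
  | ht a b => rw [endTensor_mapL]; rcases h with h | h <;> simp [h]

theorem endTensor_mul (f : (E →L[ℂ] E) →ₗ[ℂ] (E' →L[ℂ] E'))
    (g : (F →L[ℂ] F) →ₗ[ℂ] (F' →L[ℂ] F')) (hf : ∀ a b, f (a * b) = f a * f b)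
    (hg : ∀ a b, g (a * b) = g a * g b) (x y : E ⊗[ℂ] F →L[ℂ] E ⊗[ℂ] F) :
    endTensor f g (x * y) = endTensor f g x * endTensor f g y := by
  induction x using end_tensor_induction with
  | h0 => simp
  | ha x x' hx hx' => simp [add_mul, hx, hx']
  | ht a b =>
    induction y using end_tensor_induction with
    | h0 => simp
    | ha x x' hx hx' => simp [mul_add, hx, hx']
    | ht a' b' => simp only [← TensorProduct.mapL_mul, endTensor_mapL, hf, hg]

theorem endTensor_star [CompleteSpace E] [CompleteSpace F] [CompleteSpace E'] [CompleteSpace F']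
    [CompleteSpace (E ⊗[ℂ] F)] [CompleteSpace (E' ⊗[ℂ] F')]
    (f : (E →L[ℂ] E) →ₗ[ℂ] (E' →L[ℂ] E'))
    (g : (F →L[ℂ] F) →ₗ[ℂ] (F' →L[ℂ] F')) (hf : ∀ a, f (star a) = star (f a))
    (hg : ∀ a, g (star a) = star (g a)) (x : E ⊗[ℂ] F →L[ℂ] E ⊗[ℂ] F) :
    endTensor f g (star x) = star (endTensor f g x) := by
  induction x using end_tensor_induction with
  | h0 => simp only [ContinuousLinearMap.star_eq_adjoint, map_zero]
  | ha x x' hx hx' =>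
    simp only [ContinuousLinearMap.star_eq_adjoint] at *
    rw [map_add, map_add, map_add, map_add, hx, hx']
  | ht a b =>
    simp only [ContinuousLinearMap.star_eq_adjoint] at *
    simp only [TensorProduct.adjoint_mapL, endTensor_mapL, hf, hg]

end endTensor

theorem endTensor_mul_zero {E F E' F' G H : Type*}
    [NormedAddCommGroup E] [InnerProductSpace ℂ E] [FiniteDimensional ℂ E]
    [NormedAddCommGroup F] [InnerProductSpace ℂ F] [FiniteDimensional ℂ F]
    [NormedAddCommGroup E'] [InnerProductSpace ℂ E'] [FiniteDimensional ℂ E']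
    [NormedAddCommGroup F'] [InnerProductSpace ℂ F'] [FiniteDimensional ℂ F']
    [NormedAddCommGroup G] [InnerProductSpace ℂ G] [FiniteDimensional ℂ G]
    [NormedAddCommGroup H] [InnerProductSpace ℂ H] [FiniteDimensional ℂ H]
    (f : (E →L[ℂ] E) →ₗ[ℂ] (E' →L[ℂ] E')) (g : (F →L[ℂ] F) →ₗ[ℂ] (F' →L[ℂ] F'))
    (f' : (G →L[ℂ] G) →ₗ[ℂ] (E' →L[ℂ] E')) (g' : (H →L[ℂ] H) →ₗ[ℂ] (F' →L[ℂ] F'))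
    (h : (∀ a b, f a * f' b = 0) ∨ (∀ a b, g a * g' b = 0))
    (x : E ⊗[ℂ] F →L[ℂ] E ⊗[ℂ] F) (y : G ⊗[ℂ] H →L[ℂ] G ⊗[ℂ] H) :
    endTensor f g x * endTensor f' g' y = 0 := by
  induction x using end_tensor_induction with
  | h0 => simp
  | ha x x' hx hx' => simp [add_mul, hx, hx']
  | ht a b =>
    induction y using end_tensor_induction with
    | h0 => simp
    | ha x x' hx hx' => simp [mul_add, hx, hx']
    | ht a' b' =>
      rw [endTensor_mapL, endTensor_mapL, ← TensorProduct.mapL_mul]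
      rcases h with h | h <;> simp [h]

section tensorHom

variable {X : QuantumSet.{u, v}} {Y : QuantumSet.{u', v'}}

/-- The component `L(Y_j) → L(X_i)` of a `*`-homomorphism `ψ : ℓ^∞(Y) → ℓ^∞(X)`. -/
def block (ψ : LInf Y →⋆ₐ[ℂ] LInf X) (i : X.At) (j : Y.At) :
    (Y.space j →L[ℂ] Y.space j) →ₗ[ℂ] (X.space i →L[ℂ] X.space i) where
  toFun b := ψ (LInf.single j b) i
  map_add' a b := by rw [LInf.single_add, map_add, LInf.add_apply]
  map_smul' c b := by rw [LInf.single_smul, map_smul, LInf.smul_apply, RingHom.id_apply]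

theorem block_apply (ψ : LInf Y →⋆ₐ[ℂ] LInf X) (i : X.At) (j : Y.At)
    (b : Y.space j →L[ℂ] Y.space j) : block ψ i j b = ψ (LInf.single j b) i := rfl

theorem block_mul (ψ : LInf Y →⋆ₐ[ℂ] LInf X) (i : X.At) (j : Y.At)
    (a b : Y.space j →L[ℂ] Y.space j) :
    block ψ i j (a * b) = block ψ i j a * block ψ i j b := by
  simp only [block_apply, LInf.single_mul, map_mul, LInf.mul_apply]

theorem block_mul_ne (ψ : LInf Y →⋆ₐ[ℂ] LInf X) (i : X.At) {j k : Y.At} (h : j ≠ k)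
    (a : Y.space j →L[ℂ] Y.space j) (b : Y.space k →L[ℂ] Y.space k) :
    block ψ i j a * block ψ i k b = 0 := by
  rw [block_apply, block_apply, ← LInf.mul_apply, ← map_mul, LInf.single_mul_ne h, map_zero,
    LInf.zero_apply]

theorem block_star (ψ : LInf Y →⋆ₐ[ℂ] LInf X) (i : X.At) (j : Y.At)
    (a : Y.space j →L[ℂ] Y.space j) : block ψ i j (star a) = star (block ψ i j a) := by
  simp only [block_apply, LInf.single_star, map_star, LInf.star_apply]

/-- As `X_i` is finite-dimensional, all but finitely many components `L(Y_j) → L(X_i)` vanish. -/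
theorem block_finite (ψ : LInf Y →⋆ₐ[ℂ] LInf X) (i : X.At) :
    {j | block ψ i j ≠ 0}.Finite := by
  have h1 : ∀ j, block ψ i j ≠ 0 → block ψ i j 1 ≠ 0 := by
    intro j hj h0
    apply hj
    ext1 a
    have := block_mul ψ i j a 1
    rw [h0] at this
    simpa using this
  have hli : LinearIndependent ℂ (fun j : {j | block ψ i j ≠ 0} => block ψ i j.1 1) := by
    rw [linearIndependent_iff']
    intro s g hg k hk
    have := congrArg (· * block ψ i k.1 1) hg
    simp only [Finset.sum_mul, zero_mul, smul_mul_assoc] at this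
    rw [Finset.sum_eq_single k] at this
    · rw [← block_mul, mul_one] at this
      exact (smul_eq_zero.mp this).resolve_right (h1 _ k.2)
    · intro b _ hb
      rw [block_mul_ne ψ i (fun h => hb (Subtype.ext h)), smul_zero]
    · exact fun h => absurd hk h
  have := hli.finite
  exact Set.toFinite _

variable {X' : QuantumSet.{u'', v''}} {Y' : QuantumSet.{u₁, v₁}}

/-- The component `L(Y_j ⊗ Y'_j') → L(X_i ⊗ X'_i')` of `ψ ⊗̄ ψ'`. -/
def blockTensor (ψ : LInf Y →⋆ₐ[ℂ] LInf X) (ψ' : LInf Y' →⋆ₐ[ℂ] LInf X')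
    (p : (X.prod X').At) (q : (Y.prod Y').At) :
    ((Y.prod Y').space q →L[ℂ] (Y.prod Y').space q) →ₗ[ℂ]
      ((X.prod X').space p →L[ℂ] (X.prod X').space p) :=
  endTensor (block ψ p.1 q.1) (block ψ' p.2 q.2)

theorem blockTensor_finite (ψ : LInf Y →⋆ₐ[ℂ] LInf X) (ψ' : LInf Y' →⋆ₐ[ℂ] LInf X')
    (p : (X.prod X').At) : {q | blockTensor ψ ψ' p q ≠ 0}.Finite := by
  refine ((block_finite ψ p.1).prod (block_finite ψ' p.2)).subset fun q hq => ?_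
  refine ⟨fun h => hq ?_, fun h => hq ?_⟩
  · exact endTensor_eq_zero _ _ (by simp [h])
  · exact endTensor_eq_zero _ _ (by simp [h])

theorem blockTensor_support (ψ : LInf Y →⋆ₐ[ℂ] LInf X) (ψ' : LInf Y' →⋆ₐ[ℂ] LInf X')
    (p : (X.prod X').At) (x : LInf (Y.prod Y')) :
    (Function.support fun q => blockTensor ψ ψ' p q (x q)) ⊆
      (blockTensor_finite ψ ψ' p).toFinset := by
  intro q hq
  simp only [Set.Finite.coe_toFinset, Set.mem_ofPred_eq]
  intro h
  simp [h] at hq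

/-- The component of `ψ ⊗̄ ψ'` with values in `L(X_i ⊗ X'_i')`. It is a finite sum. -/
def tensorHomAt (ψ : LInf Y →⋆ₐ[ℂ] LInf X) (ψ' : LInf Y' →⋆ₐ[ℂ] LInf X')
    (p : (X.prod X').At) :
    LInf (Y.prod Y') →⋆ₙₐ[ℂ] ((X.prod X').space p →L[ℂ] (X.prod X').space p) where
  toFun x := ∑ᶠ q, blockTensor ψ ψ' p q (x q)
  map_smul' c x := by
    simp only [finsum_eq_sum_of_support_subset _ (blockTensor_support ψ ψ' p _)]
    simp [Finset.smul_sum]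
  map_zero' := by simp
  map_add' x y := by
    simp only [finsum_eq_sum_of_support_subset _ (blockTensor_support ψ ψ' p _)]
    simp [Finset.sum_add_distrib]
  map_mul' x y := by
    simp only [finsum_eq_sum_of_support_subset _ (blockTensor_support ψ ψ' p _)]
    rw [Finset.sum_mul_sum]
    refine Finset.sum_congr rfl fun q hq => ?_
    rw [Finset.sum_eq_single q]
    · exact endTensor_mul _ _ (block_mul _ _ _) (block_mul _ _ _) _ _
    · intro r _ hr
      refine endTensor_mul_zero _ _ _ _ ?_ _ _
      by_cases h : q.1 = r.1
      · right
        exact block_mul_ne _ _ fun h' => hr (Prod.ext h.symm h'.symm)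
      · left
        exact block_mul_ne _ _ h
    · exact fun h => absurd hq h
  map_star' x := by
    simp only [finsum_eq_sum_of_support_subset _ (blockTensor_support ψ ψ' p _)]
    rw [star_sum]
    exact Finset.sum_congr rfl fun q _ =>
      endTensor_star _ _ (block_star _ _ _) (block_star _ _ _) _

/-- The tensor product `ψ ⊗̄ ψ' : ℓ^∞(Y) ⊗̄ ℓ^∞(Y') → ℓ^∞(X) ⊗̄ ℓ^∞(X')` of `W*`-morphisms
`ψ : ℓ^∞(Y) → ℓ^∞(X)` and `ψ' : ℓ^∞(Y') → ℓ^∞(X')`. Its component at `(i, i')` is the finite sum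
over `(j, j')` of the maps `L(Y_j ⊗ Y'_j') → L(X_i ⊗ X'_i')` that send `b ⊗ b'` to
`ψ(b)_i ⊗ ψ'(b')_i'`; for normal `ψ`, `ψ'` it sends `a ⊗ a'` to `ψ(a) ⊗ ψ'(a')`. -/
def tensorHom (ψ : LInf Y →⋆ₐ[ℂ] LInf X) (ψ' : LInf Y' →⋆ₐ[ℂ] LInf X') :
    LInf (Y.prod Y') →⋆ₙₐ[ℂ] LInf (X.prod X') where
  toFun x := LInf.mk (fun p => tensorHomAt ψ ψ' p x) ‖x‖ fun p =>
    NonUnitalStarAlgHom.norm_apply_le (tensorHomAt ψ ψ' p) x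
  map_smul' c x := by ext1 p; exact map_smul (tensorHomAt ψ ψ' p) c x
  map_zero' := by ext1 p; exact map_zero (tensorHomAt ψ ψ' p)
  map_add' x y := by ext1 p; exact map_add (tensorHomAt ψ ψ' p) x y
  map_mul' x y := by ext1 p; exact map_mul (tensorHomAt ψ ψ' p) x y
  map_star' x := by ext1 p; exact map_star (tensorHomAt ψ ψ' p) x

end tensorHom

/-! ### The opposite algebra -/

/-- The atom of `X` of which an atom of `X*` is the dual. -/
def QuantumSet.predual {X : QuantumSet.{u, v}} (i : X.dual.At) : X.At := i

theorem toDual_symm_precomp {E : Type*} [NormedAddCommGroup E] [InnerProductSpace ℂ E]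
    [CompleteSpace E] (a : E →L[ℂ] E) (f : StrongDual ℂ E) :
    (InnerProductSpace.toDual ℂ E).symm (f ∘L a) =
      ContinuousLinearMap.adjoint a ((InnerProductSpace.toDual ℂ E).symm f) := by
  refine ext_inner_right ℂ fun x => ?_
  rw [InnerProductSpace.toDual_symm_apply, ContinuousLinearMap.adjoint_inner_left,
    InnerProductSpace.toDual_symm_apply]
  rfl

section transpose

variable {E : Type*} [NormedAddCommGroup E] [InnerProductSpace ℂ E]

/-- The transpose `f ↦ f ∘ a` of an operator `a`. -/
def transpose (a : E →L[ℂ] E) : StrongDual ℂ E →L[ℂ] StrongDual ℂ E :=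
  ContinuousLinearMap.precomp ℂ a

theorem transpose_one : transpose (1 : E →L[ℂ] E) = 1 := rfl

theorem transpose_zero : transpose (0 : E →L[ℂ] E) = 0 := by
  ext f x; simp [transpose]

theorem transpose_mul (a b : E →L[ℂ] E) : transpose (b * a) = transpose a * transpose b := rfl

theorem transpose_add (a b : E →L[ℂ] E) : transpose (a + b) = transpose a + transpose b := by
  ext f x; simp [transpose]

theorem transpose_smul (c : ℂ) (a : E →L[ℂ] E) : transpose (c • a) = c • transpose a := by
  ext f x; simp [transpose]

theorem norm_transpose_le (a : E →L[ℂ] E) : ‖transpose a‖ ≤ ‖a‖ := by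
  refine ContinuousLinearMap.opNorm_le_bound _ (norm_nonneg a) fun f => ?_
  rw [mul_comm]
  exact ContinuousLinearMap.opNorm_comp_le f a

end transpose

/-- The transpose of an operator on an atom of `X`, as an operator on the dual atom of `X*`. -/
def transposeAt {X : QuantumSet.{u, v}} (i : X.dual.At)
    (a : X.space (QuantumSet.predual i) →L[ℂ] X.space (QuantumSet.predual i)) :
    X.dual.space i →L[ℂ] X.dual.space i :=
  transpose (E := X.space (QuantumSet.predual i)) a

theorem transposeAt_star {X : QuantumSet.{u, v}} (i : X.dual.At)
    (a : X.space (QuantumSet.predual i) →L[ℂ] X.space (QuantumSet.predual i)) :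
    transposeAt i (star a) = star (transposeAt i a) := by
  rw [ContinuousLinearMap.star_eq_adjoint (transposeAt i a), ContinuousLinearMap.eq_adjoint_iff]
  intro (f : StrongDual ℂ (X.space (QuantumSet.predual i)))
    (g : StrongDual ℂ (X.space (QuantumSet.predual i)))
  change ⟪(InnerProductSpace.toDual ℂ (X.space (QuantumSet.predual i))).symm g,
      (InnerProductSpace.toDual ℂ (X.space (QuantumSet.predual i))).symm (f ∘L star a)⟫_ℂ =
    ⟪(InnerProductSpace.toDual ℂ (X.space (QuantumSet.predual i))).symm (g ∘L a),
      (InnerProductSpace.toDual ℂ (X.space (QuantumSet.predual i))).symm f⟫_ℂ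
  rw [toDual_symm_precomp, toDual_symm_precomp, ContinuousLinearMap.star_eq_adjoint,
    ContinuousLinearMap.adjoint_adjoint, ContinuousLinearMap.adjoint_inner_left]

/-- The canonical isomorphism `ℓ^∞(X)^op ≅ ℓ^∞(X*)`, given on each factor by the transpose. -/
def opIso (X : QuantumSet.{u, v}) : (LInf X)ᵐᵒᵖ →⋆ₐ[ℂ] LInf X.dual where
  toFun a := LInf.mk (fun i => transposeAt i (a.unop (QuantumSet.predual i))) ‖a.unop‖ fun i =>
    (norm_transpose_le (a.unop (QuantumSet.predual i))).trans
      (a.unop.norm_apply_le (QuantumSet.predual i))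
  map_one' := by ext1 i; exact transpose_one (E := X.space (QuantumSet.predual i))
  map_mul' a b := by
    ext1 i; exact transpose_mul (E := X.space (QuantumSet.predual i)) _ _
  map_zero' := by ext1 i; exact transpose_zero (E := X.space (QuantumSet.predual i))
  map_add' a b := by
    ext1 i; exact transpose_add (E := X.space (QuantumSet.predual i)) _ _
  commutes' c := by
    ext1 i; exact transpose_smul (E := X.space (QuantumSet.predual i)) c 1
  map_star' a := by ext1 i; exact transposeAt_star i (a.unop (QuantumSet.predual i))

/-- The canonical isomorphism `ℂ ≅ ℓ^∞(1)`. -/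
def scalarIso : ℂ →⋆ₐ[ℂ] LInf QuantumSet.one := StarAlgHom.ofId ℂ _

/-! ### Discrete quantum monoids and diagonal states -/

/-- The atom `X_i ⊗ (Y_j ⊗ Z_k)` corresponding to the atom `(X_i ⊗ Y_j) ⊗ Z_k`. -/
def QuantumSet.reassoc {X : QuantumSet.{u, v}} {Y : QuantumSet.{u', v'}}
    {Z : QuantumSet.{u'', v''}} (p : ((X.prod Y).prod Z).At) : (X.prod (Y.prod Z)).At :=
  (p.1.1, (p.1.2, p.2))

/-- The associator `(X_i ⊗ Y_j) ⊗ Z_k ≅ X_i ⊗ (Y_j ⊗ Z_k)`. -/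
def assocAtom {X : QuantumSet.{u, v}} {Y : QuantumSet.{u', v'}}
    {Z : QuantumSet.{u'', v''}} (p : ((X.prod Y).prod Z).At) :
    ((X.prod Y).prod Z).space p ≃ₗ[ℂ] (X.prod (Y.prod Z)).space (QuantumSet.reassoc p) :=
  TensorProduct.assoc ℂ (X.space p.1.1) (Y.space p.1.2) (Z.space p.2)

/-- A discrete quantum monoid with underlying von Neumann algebra `M = ℓ^∞(X)`: `W*`-morphisms
`Δ : M → M ⊗̄ M` and `ε : M → ℂ` such that `(Δ ⊗̄ id) ∘ Δ = (id ⊗̄ Δ) ∘ Δ`,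
`(ε ⊗̄ id) ∘ Δ = id` and `(id ⊗̄ ε) ∘ Δ = id`, modulo the canonical identifications
`(M ⊗̄ M) ⊗̄ M = M ⊗̄ (M ⊗̄ M)` and `ℂ ⊗̄ M = M = M ⊗̄ ℂ` (that is, `1 ⊗ a = a = a ⊗ 1`). -/
structure DiscreteQuantumMonoid (X : QuantumSet.{u, v}) where
  comul : WStarHom (LInf X) (LInf (X.prod X))
  counit : WStarHom (LInf X) ℂ
  coassoc : ∀ (a : LInf X) (p : ((X.prod X).prod X).At) (x : ((X.prod X).prod X).space p),
    assocAtom p (tensorHom comul.toStarAlgHom (StarAlgHom.id ℂ (LInf X))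
        (comul.toStarAlgHom a) p x) =
      tensorHom (StarAlgHom.id ℂ (LInf X)) comul.toStarAlgHom (comul.toStarAlgHom a)
        (QuantumSet.reassoc p) (assocAtom p x)
  counit_left : ∀ a : LInf X,
    tensorHom (scalarIso.comp counit.toStarAlgHom) (StarAlgHom.id ℂ (LInf X))
      (comul.toStarAlgHom a) = LInf.tmul 1 a
  counit_right : ∀ a : LInf X,
    tensorHom (StarAlgHom.id ℂ (LInf X)) (scalarIso.comp counit.toStarAlgHom)
      (comul.toStarAlgHom a) = LInf.tmul a 1

/-- Diagonal states on `M ⊗̄ M^op`, for `M = ℓ^∞(X)`: normal states that vanish on `p ⊗ (1 - p)`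
for every projection `p ∈ M`. -/
structure IsDiagonalState {X : QuantumSet.{u, v}} (φ : LInf (X.prod X.dual) →ₗ[ℂ] ℂ) : Prop
    extends IsNormalState φ where
  diagonal : ∀ p : LInf X, IsStarProjection p →
    φ (LInf.tmul p (opIso X (MulOpposite.op (1 - p)))) = 0

/-- Diagonal states on `M^op ⊗̄ M`, for `M = ℓ^∞(X)`: normal states that vanish on `p ⊗ (1 - p)`
for every projection `p ∈ M^op`. -/
structure IsOpDiagonalState {X : QuantumSet.{u, v}} (φ : LInf (X.dual.prod X) →ₗ[ℂ] ℂ) : Prop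
    extends IsNormalState φ where
  diagonal : ∀ p : LInf X, IsStarProjection p →
    φ (LInf.tmul (opIso X (MulOpposite.op p)) (1 - p)) = 0

/-! ### The category `qRel` of quantum sets and relations -/

/-- A relation from `X` to `Y`: a choice of subspaces `R(X_i, Y_j) ≤ L(X_i, Y_j)`. Relations are
ordered by inclusion. -/
abbrev QRel (X : QuantumSet.{u, v}) (Y : QuantumSet.{u', v'}) : Type (max u u' v v') :=
  ∀ (i : X.At) (j : Y.At), Submodule ℂ (X.space i →L[ℂ] Y.space j)

namespace QRel

variable {X : QuantumSet.{u, v}} {Y : QuantumSet.{u', v'}} {Z : QuantumSet.{u'', v''}}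
  {W : QuantumSet.{u₁, v₁}}

/-- The composite `S ∘ R`. -/
def comp (S : QRel Y Z) (R : QRel X Y) : QRel X Z := fun i k =>
  Submodule.span ℂ {T | ∃ j, ∃ s ∈ S j k, ∃ r ∈ R i j, T = s ∘L r}

/-- The adjoint relation `R†`. -/
def dagger (R : QRel X Y) : QRel Y X := fun j i =>
  Submodule.span ℂ {T | ∃ r ∈ R i j, T = ContinuousLinearMap.adjoint r}

/-- The product `R × S` of relations. -/
def prod (R : QRel X Y) (S : QRel Z W) : QRel (X.prod Z) (Y.prod W) := fun p q =>
  Submodule.span ℂ {T | ∃ r ∈ R p.1 q.1, ∃ s ∈ S p.2 q.2, T = opTensor r s}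

open Classical in
/-- The identity relation: the multiples of the identity of each atom. -/
def id (X : QuantumSet.{u, v}) : QRel X X := fun i j =>
  if h : i = j then Submodule.span ℂ {h ▸ ContinuousLinearMap.id ℂ (X.space i)} else ⊥

/-- The relation `ψ̂ : X → Y` of a `W*`-morphism `ψ : ℓ^∞(Y) → ℓ^∞(X)`, made of its
intertwiners. -/
def hat (ψ : LInf Y →⋆ₐ[ℂ] LInf X) : QRel X Y := fun i j =>
  { carrier := {T | ∀ a : LInf Y, a j ∘L T = T ∘L ψ a i}
    add_mem' := fun hS hT a => by
      rw [ContinuousLinearMap.comp_add, ContinuousLinearMap.add_comp, hS, hT]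
    zero_mem' := fun a => by rw [ContinuousLinearMap.comp_zero, ContinuousLinearMap.zero_comp]
    smul_mem' := fun c T hT a => by
      rw [ContinuousLinearMap.comp_smul, ContinuousLinearMap.smul_comp, hT] }

open Classical in
/-- The pairing `X_i* × X_j → ℂ`: it is `(f, x) ↦ f x` if `i = j`, and zero otherwise. -/
def pairing (X : QuantumSet.{u, v}) (i j : X.At) :
    StrongDual ℂ (X.space i) →ₗ[ℂ] X.space j →ₗ[ℂ] ℂ :=
  if h : i = j then h ▸ (ContinuousLinearMap.coeLM ℂ : StrongDual ℂ (X.space i) →ₗ[ℂ] _) else 0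

/-- The functional `f ⊗ x ↦ f x` on the atom `X_i* ⊗ X_j` of `X* × X`, zero if `i ≠ j`. -/
def evFun (X : QuantumSet.{u, v}) (p : (X.dual.prod X).At) :
    (X.dual.prod X).space p →ₗ[ℂ] ℂ :=
  TensorProduct.lift (pairing X (QuantumSet.predual p.1) p.2)

/-- The functional `x ⊗ f ↦ f x` on the atom `X_i ⊗ X_j*` of `X × X*`, zero if `i ≠ j`. -/
def evDualFun (X : QuantumSet.{u, v}) (p : (X.prod X.dual).At) :
    (X.prod X.dual).space p →ₗ[ℂ] ℂ :=
  TensorProduct.lift (pairing X (QuantumSet.predual p.2) p.1).flip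

/-- The evaluation `ev_X : X* × X → 1`, spanned on each atom by `f ⊗ x ↦ f x`. -/
def ev (X : QuantumSet.{u, v}) : QRel (X.dual.prod X) QuantumSet.one := fun p _ =>
  Submodule.span ℂ {LinearMap.toContinuousLinearMap (evFun X p)}

/-- The evaluation `ev_{X*} : X × X* → 1`, where the atoms `X_i**` of `X**` are identified with
those of `X` as usual: it is spanned on each atom by `x ⊗ f ↦ f x`. -/
def evDual (X : QuantumSet.{u, v}) : QRel (X.prod X.dual) QuantumSet.one := fun p _ =>
  Submodule.span ℂ {LinearMap.toContinuousLinearMap (evDualFun X p)}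

end QRel

/-- The relation `ε̂ : 1 → X`. -/
def DiscreteQuantumMonoid.counitRel {X : QuantumSet.{u, v}} (M : DiscreteQuantumMonoid X) :
    QRel QuantumSet.one X :=
  QRel.hat (scalarIso.comp M.counit.toStarAlgHom)

/-- The relation `Δ̂ : X × X → X`. -/
def DiscreteQuantumMonoid.comulRel {X : QuantumSet.{u, v}} (M : DiscreteQuantumMonoid X) :
    QRel (X.prod X) X :=
  QRel.hat M.comul.toStarAlgHom

/-- A `W*`-morphism `s : ℓ^∞(X) → ℓ^∞(X)^op`, seen as a homomorphism `ℓ^∞(X) → ℓ^∞(X*)`. -/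
def toDualHom {X : QuantumSet.{u, v}} (s : WStarHom (LInf X) (LInf X)ᵐᵒᵖ) :
    LInf X →⋆ₐ[ℂ] LInf X.dual :=
  (opIso X).comp s.toStarAlgHom

/-- The relation `ŝ : X* → X` of a `W*`-morphism `s : ℓ^∞(X) → ℓ^∞(X)^op`. -/
def antipodeRel {X : QuantumSet.{u, v}} (s : WStarHom (LInf X) (LInf X)ᵐᵒᵖ) : QRel X.dual X :=
  QRel.hat (toDualHom s)

/-- `φ ∘ (s ⊗̄ id) ∘ Δ = ε` for all diagonal states `φ` on `M^op ⊗̄ M`. -/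
def DiscreteQuantumMonoid.LeftDiagonalCondition {X : QuantumSet.{u, v}}
    (M : DiscreteQuantumMonoid X) (s : WStarHom (LInf X) (LInf X)ᵐᵒᵖ) : Prop :=
  ∀ φ : LInf (X.dual.prod X) →ₗ[ℂ] ℂ, IsOpDiagonalState φ → ∀ a : LInf X,
    φ (tensorHom (toDualHom s) (StarAlgHom.id ℂ (LInf X)) (M.comul.toStarAlgHom a)) =
      M.counit.toStarAlgHom a

/-- `φ ∘ (id ⊗̄ s) ∘ Δ = ε` for all diagonal states `φ` on `M ⊗̄ M^op`. -/
def DiscreteQuantumMonoid.RightDiagonalCondition {X : QuantumSet.{u, v}}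
    (M : DiscreteQuantumMonoid X) (s : WStarHom (LInf X) (LInf X)ᵐᵒᵖ) : Prop :=
  ∀ φ : LInf (X.prod X.dual) →ₗ[ℂ] ℂ, IsDiagonalState φ → ∀ a : LInf X,
    φ (tensorHom (StarAlgHom.id ℂ (LInf X)) (toDualHom s) (M.comul.toStarAlgHom a)) =
      M.counit.toStarAlgHom a

end

/-! Put Ψ = (s ⊗̄ id)Δ and let g be the family of evaluation functionals on the atoms of X* × X.
Every condition of the left-hand case is equivalent to one eigenvalue equation, `IsEigenfunctional`:
g(Ψ(a)w) = ε(a) g(w) for all a and w. By adjunction, the Riesz vector t of g satisfies Ψ(a)t =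
ε(a)t. The right-hand case is the same with the tensor legs exchanged.

States. The kernel of g is spanned by the f ⊗ x with f(x) = 0 (`mem_of_lift_eq_zero`), and a
projection q with fq = f and qx = 0 makes q ⊗ (1 - q) fix such a tensor. By Cauchy–Schwarz a
diagonal state therefore kills every operator with range in ker g. The eigenvalue equation says that
Ψ(a) - ε(a) is such an operator on each atom, and normality passes from the atoms to the whole
algebra. Conversely, the vector state of t/‖t‖ is diagonal; if it restricts to the character ε along
Ψ, then Ψ(a) has variance zero in it, so t is an eigenvector.

Relations. R = Δ̂ ∘ (ŝ × id) intertwines Ψ with the action of M, and it is separating: its operators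
out of an atom have zero joint kernel. This is where normality of Δ and s enters (`hat_separating`,
`Separating.prod`). Operators of R carry t to ε-eigenvectors in the atoms of X, some of them nonzero
if t ≠ 0. An atom that contains a nonzero ε-eigenvector is a line and is the only such atom. Both ev
≤ ε̂† ∘ R and R ∘ ev† = ε̂ can then be read off on that line, and each of them gives back the
eigenvalue equation. -/

noncomputable section

/-! ### Truncations, projections and the componentwise order of ℓ^∞(X) -/

namespace LInf

variable {X : QuantumSet.{u, v}}

open Classical in
/-- The central projection of `ℓ^∞(X)` onto the atoms in a finite set. -/
def trunc (F : Finset X.At) : LInf X := ∑ i ∈ F, single i 1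

theorem sum_apply {ι : Type*} (F : Finset ι) (a : ι → LInf X) (i : X.At) :
    (∑ k ∈ F, a k) i = ∑ k ∈ F, a k i := by
  classical
  induction F using Finset.induction_on with
  | empty => simp
  | insert k F hk ih => rw [Finset.sum_insert hk, Finset.sum_insert hk, add_apply, ih]

theorem trunc_apply_of_mem {F : Finset X.At} {i : X.At} (h : i ∈ F) : trunc F i = 1 := by
  rw [trunc, sum_apply, Finset.sum_eq_single i]
  · rw [single_self]
  · intro k _ hk
    exact single_ne hk.symm _
  · exact fun h' => absurd h h'

theorem trunc_apply_of_notMem {F : Finset X.At} {i : X.At} (h : i ∉ F) : trunc F i = 0 := by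
  rw [trunc, sum_apply]
  refine Finset.sum_eq_zero fun k hk => single_ne ?_ _
  rintro rfl
  exact h hk

theorem isStarProjection_of_apply {a : LInf X} (h : ∀ i, IsStarProjection (a i)) :
    IsStarProjection a := by
  refine ⟨?_, ?_⟩
  · ext1 i
    exact (h i).isIdempotentElem
  · ext1 i
    exact (h i).isSelfAdjoint

theorem isStarProjection_trunc (F : Finset X.At) : IsStarProjection (trunc F) := by
  refine isStarProjection_of_apply fun i => ?_
  by_cases h : i ∈ F
  · rw [trunc_apply_of_mem h]; exact .one _
  · rw [trunc_apply_of_notMem h]; exact .zero _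

theorem isStarProjection_single {i : X.At} {b : X.space i →L[ℂ] X.space i}
    (hb : IsStarProjection b) : IsStarProjection (single i b) := by
  refine ⟨?_, ?_⟩
  · rw [IsIdempotentElem, ← single_mul, hb.isIdempotentElem.eq]
  · rw [IsSelfAdjoint, ← single_star, hb.isSelfAdjoint.star_eq]

theorem mul_single (a : LInf X) (i : X.At) (b : X.space i →L[ℂ] X.space i) :
    a * single i b = single i (a i * b) :=
  ext_single (j := i) (by simp) fun k hk => by simp [single_ne hk]

theorem single_sum (j : X.At) {ι : Type*} (F : Finset ι) (b : ι → X.space j →L[ℂ] X.space j) :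
    single j (∑ k ∈ F, b k) = ∑ k ∈ F, single j (b k) := by
  refine ext_single (j := j) ?_ fun i hi => ?_
  · rw [single_self, sum_apply]
    exact Finset.sum_congr rfl fun k _ => (single_self j (b k)).symm
  · rw [single_ne hi, sum_apply]
    exact (Finset.sum_eq_zero fun k _ => single_ne hi (b k)).symm

/-- An element of `ℓ^∞(X)` is positive as soon as its components are. -/
theorem starLE_of_apply {a b : LInf X} (h : ∀ i, StarLE (a i) (b i)) : StarLE a b := by
  choose c hc using h
  refine ⟨mk c (Real.sqrt ‖b - a‖) fun i => ?_, ?_⟩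
  · refine Real.le_sqrt_of_sq_le ?_
    rw [sq, ← CStarRing.norm_star_mul_self, ← hc]
    exact norm_apply_le (b - a) i
  · ext1 i
    exact hc i

theorem starLE_apply {a b : LInf X} (h : StarLE a b) (i : X.At) : StarLE (a i) (b i) := by
  obtain ⟨c, hc⟩ := h
  exact ⟨c i, by rw [← sub_apply, hc]; rfl⟩

end LInf

theorem starLE_of_isStarProjection {A : Type*} [Ring A] [StarRing A] {a b : A}
    (h : IsStarProjection (b - a)) : StarLE a b :=
  ⟨b - a, by rw [h.isSelfAdjoint.star_eq, h.isIdempotentElem.eq]⟩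

theorem starLE_iff_isPositive {E : Type*} [NormedAddCommGroup E] [InnerProductSpace ℂ E]
    [CompleteSpace E] {a b : E →L[ℂ] E} : StarLE a b ↔ (b - a).IsPositive := by
  constructor
  · rintro ⟨c, hc⟩
    rw [hc]
    have := ContinuousLinearMap.IsPositive.adjoint_conj
      (ContinuousLinearMap.isPositive_one (𝕜 := ℂ) (E := E)) c
    simpa [ContinuousLinearMap.star_eq_adjoint, ContinuousLinearMap.mul_def,
      ContinuousLinearMap.one_def] using this
  · intro h
    rw [← ContinuousLinearMap.nonneg_iff_isPositive] at h
    obtain ⟨c, hc⟩ := CStarAlgebra.nonneg_iff_eq_star_mul_self.mp h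
    exact ⟨c, hc⟩

theorem starLE_complex_iff {a b : ℂ} : StarLE a b ↔ a ≤ b := by
  rw [← sub_nonneg, CStarAlgebra.nonneg_iff_eq_star_mul_self]
  rfl

/-! ### Normality tested on truncations, and nondegeneracy -/

namespace LInf

variable {X : QuantumSet.{u, v}}

/-- The order is componentwise, and the truncation to `{i}` is already the unit on the atom `i`. -/
theorem isStarSup_trunc : IsStarSup (Set.range (trunc (X := X))) 1 := by
  refine ⟨?_, fun y hy => starLE_of_apply fun i => ?_⟩
  · rintro _ ⟨F, rfl⟩
    exact starLE_of_isStarProjection (isStarProjection_trunc F).one_sub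
  · have := starLE_apply (hy _ ⟨{i}, rfl⟩) i
    rwa [trunc_apply_of_mem (Finset.mem_singleton_self i)] at this

theorem isStarSup_image_trunc {B : Type*} [Ring B] [StarRing B] {f : LInf X → B}
    (hf : IsNormalMap f) : IsStarSup (f '' Set.range (trunc (X := X))) (f 1) := by
  classical
  refine hf _ _ ⟨_, ∅, rfl⟩ ?_ ?_ isStarSup_trunc
  · rintro _ ⟨F, rfl⟩
    exact (isStarProjection_trunc F).isSelfAdjoint
  · have key : ∀ F G : Finset X.At, F ⊆ G → StarLE (trunc F) (trunc G) := by
      intro F G h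
      refine starLE_of_isStarProjection (isStarProjection_of_apply fun i => ?_)
      by_cases hF : i ∈ F
      · rw [sub_apply, trunc_apply_of_mem hF, trunc_apply_of_mem (h hF), sub_self]; exact .zero _
      · rw [sub_apply, trunc_apply_of_notMem hF, sub_zero]
        exact ⟨congrArg (fun z : LInf X => z i) (isStarProjection_trunc G).isIdempotentElem.eq,
          congrArg (fun z : LInf X => z i) (isStarProjection_trunc G).isSelfAdjoint.star_eq⟩
    rintro _ ⟨F, rfl⟩ _ ⟨G, rfl⟩
    exact ⟨_, ⟨F ∪ G, rfl⟩, key _ _ Finset.subset_union_left, key _ _ Finset.subset_union_right⟩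

/-- A projection orthogonal to the images of all minimal central projections under a normal
unital homomorphism is zero, in the sense that its opposite is positive. -/
theorem exists_neg_eq_star_mul_self {B : Type*} [Ring B] [StarRing B] [Algebra ℂ B]
    (ψ : WStarHom (LInf X) B) {P : B} (hP : IsStarProjection P)
    (h : ∀ k, ψ.toStarAlgHom (single k 1) * P = 0) : ∃ c : B, -P = star c * c := by
  have hsup := isStarSup_image_trunc ψ.normal
  have h1 : ψ.toFun 1 = 1 := ψ.map_one'
  rw [h1] at hsup
  -- `P` is orthogonal to the image of every truncation, so `1 - P` is an upper bound of these
  -- images; their supremum is `1`, whence `1 ≤ 1 - P`.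
  obtain ⟨c, hc⟩ := hsup.2 (1 - P) (by
    rintro _ ⟨_, ⟨F, rfl⟩, rfl⟩
    have hF : IsStarProjection (ψ.toStarAlgHom (trunc F)) := by
      refine ⟨?_, ?_⟩
      · rw [IsIdempotentElem, ← map_mul, (isStarProjection_trunc F).isIdempotentElem.eq]
      · rw [IsSelfAdjoint, ← map_star, (isStarProjection_trunc F).isSelfAdjoint.star_eq]
    have h0 : ψ.toStarAlgHom (trunc F) * P = 0 := by
      rw [trunc, map_sum, Finset.sum_mul]
      exact Finset.sum_eq_zero fun k _ => h k
    have h0' : P * ψ.toStarAlgHom (trunc F) = 0 := by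
      have := congrArg star h0
      rwa [star_mul, star_zero, hF.isSelfAdjoint.star_eq, hP.isSelfAdjoint.star_eq] at this
    change StarLE (ψ.toStarAlgHom (trunc F)) (1 - P)
    refine starLE_of_isStarProjection ?_
    have h2 : IsStarProjection (P + ψ.toStarAlgHom (trunc F)) := by
      refine ⟨?_, hP.isSelfAdjoint.add hF.isSelfAdjoint⟩
      rw [IsIdempotentElem, add_mul, mul_add, mul_add, h0, h0', hP.isIdempotentElem.eq,
        hF.isIdempotentElem.eq]
      abel
    rw [sub_sub]
    exact h2.one_sub)
  exact ⟨c, by rw [← hc]; abel⟩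

end LInf

/-- A homomorphism `ℓ^∞(Y) → ℓ^∞(X)` is nondegenerate if no nonzero vector of an atom of `X` is
annihilated by the images of all minimal central projections of `ℓ^∞(Y)`. -/
def Nondegenerate {X : QuantumSet.{u, v}} {Y : QuantumSet.{u', v'}}
    (ψ : LInf Y →⋆ₐ[ℂ] LInf X) : Prop :=
  ∀ (i : X.At) (w : X.space i), (∀ k, ψ (LInf.single k 1) i w = 0) → w = 0

section

variable {X : QuantumSet.{u, v}} {Y : QuantumSet.{u', v'}}

/-- Taking the expectation at `w` gives -‖w‖² = ‖c w‖². -/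
theorem eq_zero_of_neg_starProjection_eq {E : Type*} [NormedAddCommGroup E]
    [InnerProductSpace ℂ E] [FiniteDimensional ℂ E] [CompleteSpace E] {w : E} {c : E →L[ℂ] E}
    (h : -(ℂ ∙ w).starProjection = star c * c) : w = 0 := by
  have h1 := congrArg (fun T : E →L[ℂ] E => ⟪w, T w⟫_ℂ) h
  simp only [ContinuousLinearMap.star_eq_adjoint, mul_apply_eq_comp,
    ContinuousLinearMap.adjoint_inner_right, neg_apply, inner_neg_right,
    Submodule.starProjection_eq_self_iff.mpr (Submodule.mem_span_singleton_self w)] at h1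
  rw [inner_self_eq_norm_sq_to_K, inner_self_eq_norm_sq_to_K] at h1
  norm_cast at h1
  have h2 : ‖w‖ ^ 2 = 0 := le_antisymm (by linarith [sq_nonneg ‖c w‖]) (sq_nonneg _)
  simpa using h2

theorem mul_starProjection_eq_zero {E : Type*} [NormedAddCommGroup E]
    [InnerProductSpace ℂ E] [FiniteDimensional ℂ E] {w : E} {q : E →L[ℂ] E} (h : q w = 0) :
    q * (ℂ ∙ w).starProjection = 0 := by
  ext x
  obtain ⟨c, hc⟩ := Submodule.mem_span_singleton.mp
    (Submodule.starProjection_apply_mem (ℂ ∙ w) x)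
  rw [mul_apply_eq_comp, ← hc, map_smul, h, smul_zero, zero_apply]

/-- A vector killed by all the ψ(1_k) spans a line whose projection is orthogonal to all of them,
which normality forbids unless the vector is zero. -/
theorem WStarHom.nondegenerate (ψ : WStarHom (LInf Y) (LInf X)) :
    Nondegenerate ψ.toStarAlgHom := by
  intro i w hw
  obtain ⟨c, hc⟩ := LInf.exists_neg_eq_star_mul_self ψ
    (P := LInf.single i (ℂ ∙ w).starProjection)
    (LInf.isStarProjection_single isStarProjection_starProjection) (fun k => by
      rw [LInf.mul_single, mul_starProjection_eq_zero (hw k)]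
      exact LInf.ext_single (j := i) (by simp) fun l hl => by simp [LInf.single_ne hl])
  have := congrArg (fun z : LInf X => z i) hc
  simp only [LInf.neg_apply, LInf.single_self] at this
  exact eq_zero_of_neg_starProjection_eq this

theorem LInf.isStarProjection_map {B : Type*} [Ring B] [StarRing B] [Algebra ℂ B]
    (ψ : LInf X →⋆ₐ[ℂ] B) {q : LInf X} (hq : IsStarProjection q) : IsStarProjection (ψ q) := by
  refine ⟨?_, ?_⟩
  · rw [IsIdempotentElem, ← map_mul, hq.isIdempotentElem.eq]
  · rw [IsSelfAdjoint, ← map_star, hq.isSelfAdjoint.star_eq]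

/-- Normality is given for `s` with values in M^op, so the argument runs there: a functional `f` on
an atom is replaced by its Riesz vector `w`, and transposes by operators on `w`. -/
theorem toDualHom_nondegenerate (s : WStarHom (LInf X) (LInf X)ᵐᵒᵖ) :
    Nondegenerate (toDualHom s) := by
  intro (i : X.At) (f : StrongDual ℂ (X.space i)) hf
  set w : X.space i := (InnerProductSpace.toDual ℂ (X.space i)).symm f with hw
  have hq : ∀ k, (s.toStarAlgHom (LInf.single k 1)).unop i w = 0 := by
    intro k
    have h1 : f ∘L ((s.toStarAlgHom (LInf.single k 1)).unop i) = 0 := hf k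
    have h2 : IsStarProjection (s.toStarAlgHom (LInf.single k 1)) :=
      LInf.isStarProjection_map _ (LInf.isStarProjection_single (.one _))
    have h3 : star ((s.toStarAlgHom (LInf.single k 1)).unop i) =
        (s.toStarAlgHom (LInf.single k 1)).unop i :=
      congrArg (fun z : (LInf X)ᵐᵒᵖ => z.unop i) h2.isSelfAdjoint.star_eq
    have h4 := toDual_symm_precomp ((s.toStarAlgHom (LInf.single k 1)).unop i) f
    rw [h1, map_zero, ← ContinuousLinearMap.star_eq_adjoint, h3] at h4
    exact h4.symm
  obtain ⟨c, hc⟩ := LInf.exists_neg_eq_star_mul_self s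
    (P := MulOpposite.op (LInf.single i (ℂ ∙ w).starProjection)) (by
      have := LInf.isStarProjection_single
        (isStarProjection_starProjection (U := (ℂ ∙ w)))
      refine ⟨?_, ?_⟩
      · exact congrArg MulOpposite.op this.isIdempotentElem.eq
      · exact congrArg MulOpposite.op this.isSelfAdjoint.star_eq) (fun k => by
      have h2 : IsStarProjection (s.toStarAlgHom (LInf.single k 1)) :=
        LInf.isStarProjection_map _ (LInf.isStarProjection_single (.one _))
      have h3 : star (s.toStarAlgHom (LInf.single k 1)).unop =
          (s.toStarAlgHom (LInf.single k 1)).unop :=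
        congrArg MulOpposite.unop h2.isSelfAdjoint.star_eq
      have h4 : (s.toStarAlgHom (LInf.single k 1)).unop *
          LInf.single i (ℂ ∙ w).starProjection = 0 := by
        rw [LInf.mul_single, mul_starProjection_eq_zero (hq k)]
        exact LInf.ext_single (j := i) (by simp) fun l hl => by simp [LInf.single_ne hl]
      -- Products in M^op are reversed; the adjoint of `h4` has the factors in the required order.
      have h5 := congrArg star h4
      rw [star_mul, star_zero, h3, ← LInf.single_star,
        (isStarProjection_starProjection (U := (ℂ ∙ w))).isSelfAdjoint.star_eq] at h5
      exact congrArg MulOpposite.op h5)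
  have h6 := congrArg (fun z : (LInf X)ᵐᵒᵖ => z.unop i) hc
  -- For the same reason `star c * c` becomes `c * star c` in M, a positive element with factor
  -- `star c`.
  have h7 : -(ℂ ∙ w).starProjection = star (star (c.unop i)) * star (c.unop i) := by
    rw [star_star]
    refine Eq.trans ?_ h6
    change _ = -(LInf.single i (ℂ ∙ w).starProjection i)
    rw [LInf.single_self]
  have h8 := eq_zero_of_neg_starProjection_eq h7
  rw [hw] at h8
  exact (InnerProductSpace.toDual ℂ (X.space i)).symm.injective (h8.trans (map_zero _).symm)

end

/-! ### Intertwining and separating relations -/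

namespace QRel

variable {X : QuantumSet.{u, v}} {Y : QuantumSet.{u', v'}} {Z : QuantumSet.{u'', v''}}
  {W : QuantumSet.{u₁, v₁}}

/-- A relation is separating if the operators in it that start at a given atom have zero joint
kernel. -/
def Separating (R : QRel X Y) : Prop :=
  ∀ (i : X.At) (w : X.space i), (∀ j, ∀ T ∈ R i j, T w = 0) → w = 0

/-- The operators in the relation intertwine the map `f : ℓ^∞(Y) → ℓ^∞(X)` with the identity. -/
def Intertwines (R : QRel X Y) (f : LInf Y → LInf X) : Prop :=
  ∀ i j, ∀ T ∈ R i j, ∀ a : LInf Y, a j ∘L T = T ∘L f a i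

theorem hat_intertwines (ψ : LInf Y →⋆ₐ[ℂ] LInf X) : (hat ψ).Intertwines ψ :=
  fun _ _ _ hT => hT

theorem Intertwines.comp {S : QRel Y Z} {R : QRel X Y} {f : LInf Y → LInf X}
    {g : LInf Z → LInf Y} (hS : S.Intertwines g) (hR : R.Intertwines f) :
    (S.comp R).Intertwines (f ∘ g) := by
  intro i k T hT a
  induction hT using Submodule.span_induction with
  | mem T hT =>
    obtain ⟨j, s, hs, r, hr, rfl⟩ := hT
    rw [← ContinuousLinearMap.comp_assoc, hS j k s hs, ContinuousLinearMap.comp_assoc,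
      hR i j r hr, ContinuousLinearMap.comp_assoc]
    rfl
  | zero => rw [ContinuousLinearMap.comp_zero, ContinuousLinearMap.zero_comp]
  | add S T _ _ hS hT => rw [ContinuousLinearMap.comp_add, ContinuousLinearMap.add_comp, hS, hT]
  | smul c T _ hT => rw [ContinuousLinearMap.comp_smul, ContinuousLinearMap.smul_comp, hT]

theorem Separating.comp {S : QRel Y Z} {R : QRel X Y} (hS : S.Separating) (hR : R.Separating) :
    (S.comp R).Separating := by
  intro i w hw
  refine hR i w fun j r hr => hS j _ fun k s hs => ?_
  exact hw k _ (Submodule.subset_span ⟨j, s, hs, r, hr, rfl⟩)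

/-- The operator `y ↦ ψ(|y⟩⟨e|) w`, the adjoint of an intertwiner. -/
def coIntertwiner (ψ : LInf Y →⋆ₐ[ℂ] LInf X) (i : X.At) (j : Y.At) (e : Y.space j)
    (w : X.space i) : Y.space j →L[ℂ] X.space i :=
  LinearMap.toContinuousLinearMap
    { toFun := fun y => ψ (LInf.single j (InnerProductSpace.rankOne ℂ y e)) i w
      map_add' := fun y z => by
        rw [map_add, add_apply, LInf.single_add, map_add, LInf.add_apply,
          add_apply]
      map_smul' := fun c y => by
        rw [map_smul, smul_apply, LInf.single_smul, map_smul,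
          LInf.smul_apply, smul_apply, RingHom.id_apply] }

theorem coIntertwiner_apply (ψ : LInf Y →⋆ₐ[ℂ] LInf X) (i : X.At) (j : Y.At) (e : Y.space j)
    (w : X.space i) (y : Y.space j) :
    coIntertwiner ψ i j e w y = ψ (LInf.single j (InnerProductSpace.rankOne ℂ y e)) i w := rfl

theorem coIntertwiner_comp (ψ : LInf Y →⋆ₐ[ℂ] LInf X) (i : X.At) (j : Y.At) (e : Y.space j)
    (w : X.space i) (a : LInf Y) :
    coIntertwiner ψ i j e w ∘L a j = ψ a i ∘L coIntertwiner ψ i j e w := by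
  ext y
  rw [ContinuousLinearMap.comp_apply, ContinuousLinearMap.comp_apply, coIntertwiner_apply,
    coIntertwiner_apply, ← InnerProductSpace.comp_rankOne, ← ContinuousLinearMap.mul_def,
    ← LInf.mul_single, map_mul, LInf.mul_apply, mul_apply_eq_comp]

/-- This is the supply of intertwiners: any vector of X_i and any vector of Y_j produce one. -/
theorem adjoint_coIntertwiner_mem (ψ : LInf Y →⋆ₐ[ℂ] LInf X) (i : X.At) (j : Y.At)
    (e : Y.space j) (w : X.space i) :
    ContinuousLinearMap.adjoint (coIntertwiner ψ i j e w) ∈ hat ψ i j := by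
  intro a
  have h := congrArg ContinuousLinearMap.adjoint (coIntertwiner_comp ψ i j e w (star a))
  rw [ContinuousLinearMap.adjoint_comp, ContinuousLinearMap.adjoint_comp, map_star,
    LInf.star_apply, LInf.star_apply, ContinuousLinearMap.star_eq_adjoint,
    ContinuousLinearMap.star_eq_adjoint, ContinuousLinearMap.adjoint_adjoint,
    ContinuousLinearMap.adjoint_adjoint] at h
  exact h

/-- The unit of L(Y_k) is a sum of rank-one projections, so the range of ψ(1_k) is spanned by ranges
of adjoints of intertwiners. A vector killed by all intertwiners is orthogonal to that range, hence
killed by the projection ψ(1_k). -/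
theorem hat_separating {ψ : LInf Y →⋆ₐ[ℂ] LInf X} (hψ : Nondegenerate ψ) :
    (hat ψ).Separating := by
  intro i w hw
  refine hψ i w fun k => ?_
  have h1 : ∀ u : X.space i, ⟪ψ (LInf.single k 1) i u, w⟫_ℂ = 0 := by
    intro u
    have hsum := (stdOrthonormalBasis ℂ (Y.space k)).sum_rankOne_eq_id
    rw [← ContinuousLinearMap.one_def] at hsum
    rw [← hsum, LInf.single_sum, map_sum, LInf.sum_apply, sum_apply, sum_inner]
    refine Finset.sum_eq_zero fun l _ => ?_
    rw [← coIntertwiner_apply, ← ContinuousLinearMap.adjoint_inner_right,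
      hw k _ (adjoint_coIntertwiner_mem ψ i k _ u), inner_zero_right]
  have hP := LInf.isStarProjection_map ψ
    (LInf.isStarProjection_single (IsStarProjection.one _) :
      IsStarProjection (LInf.single k 1))
  have h2 : star (ψ (LInf.single k 1) i) = ψ (LInf.single k 1) i :=
    congrArg (fun z : LInf X => z i) hP.isSelfAdjoint.star_eq
  have h3 := h1 w
  have h4 : ψ (LInf.single k 1) i * ψ (LInf.single k 1) i = ψ (LInf.single k 1) i :=
    congrArg (fun z : LInf X => z i) hP.isIdempotentElem.eq
  rw [← h4, mul_apply_eq_comp, ← ContinuousLinearMap.adjoint_inner_right,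
    ← ContinuousLinearMap.star_eq_adjoint, h2] at h3
  exact inner_self_eq_zero.mp h3

theorem id_mem (i : X.At) : ContinuousLinearMap.id ℂ (X.space i) ∈ id X i i := by
  rw [id, dif_pos rfl]
  exact Submodule.mem_span_singleton_self _

theorem id_separating : (id X).Separating := fun i _ hw => hw i _ (id_mem i)

theorem id_intertwines : (id X).Intertwines (StarAlgHom.id ℂ (LInf X)) := by
  intro i j T hT a
  rw [id] at hT
  split_ifs at hT with h
  · subst h
    obtain ⟨c, rfl⟩ := Submodule.mem_span_singleton.mp hT
    ext x
    simp
  · rw [Submodule.mem_bot] at hT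
    rw [hT, ContinuousLinearMap.comp_zero, ContinuousLinearMap.zero_comp]

theorem comp_assoc (T : QRel Z W) (S : QRel Y Z) (R : QRel X Y) :
    (T.comp S).comp R = T.comp (S.comp R) := by
  funext i l
  refine le_antisymm (Submodule.span_le.mpr ?_) (Submodule.span_le.mpr ?_)
  · rintro _ ⟨j, q, hq, r, hr, rfl⟩
    induction hq using Submodule.span_induction with
    | mem q hq =>
      obtain ⟨k, t, ht, s, hs, rfl⟩ := hq
      rw [ContinuousLinearMap.comp_assoc]
      exact Submodule.subset_span ⟨k, t, ht, _, Submodule.subset_span ⟨j, s, hs, r, hr, rfl⟩, rfl⟩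
    | zero => rw [ContinuousLinearMap.zero_comp]; exact Submodule.zero_mem _
    | add a b _ _ ha hb => rw [ContinuousLinearMap.add_comp]; exact Submodule.add_mem _ ha hb
    | smul c a _ ha => rw [ContinuousLinearMap.smul_comp]; exact Submodule.smul_mem _ c ha
  · rintro _ ⟨k, t, ht, q, hq, rfl⟩
    induction hq using Submodule.span_induction with
    | mem q hq =>
      obtain ⟨j, s, hs, r, hr, rfl⟩ := hq
      rw [← ContinuousLinearMap.comp_assoc]
      exact Submodule.subset_span ⟨j, _, Submodule.subset_span ⟨k, t, ht, s, hs, rfl⟩, r, hr, rfl⟩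
    | zero => rw [ContinuousLinearMap.comp_zero]; exact Submodule.zero_mem _
    | add a b _ _ ha hb => rw [ContinuousLinearMap.comp_add]; exact Submodule.add_mem _ ha hb
    | smul c a _ ha => rw [ContinuousLinearMap.comp_smul]; exact Submodule.smul_mem _ c ha

end QRel

/-! ### Tensor products of separating and intertwining relations -/

section tensor

/-- In coordinates along a basis of `F`, the operator r ⊗ id applies `r` to each coordinate. -/
theorem eq_zero_of_forall_mapL_id {E F ι : Type*} {E' : ι → Type*}
    [NormedAddCommGroup E] [InnerProductSpace ℂ E]
    [NormedAddCommGroup F] [InnerProductSpace ℂ F] [FiniteDimensional ℂ F]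
    [∀ i, NormedAddCommGroup (E' i)] [∀ i, InnerProductSpace ℂ (E' i)]
    {r : ∀ i, E →L[ℂ] E' i} (hr : ∀ x : E, (∀ i, r i x = 0) → x = 0) {t : E ⊗[ℂ] F}
    (ht : ∀ i, TensorProduct.mapL (r i) (ContinuousLinearMap.id ℂ F) t = 0) : t = 0 := by
  let b := Module.finBasis ℂ F
  have key : ∀ (i : ι) (t : E ⊗[ℂ] F) (k),
      TensorProduct.equivFinsuppOfBasisRight b (TensorProduct.mapL (r i) (.id ℂ F) t) k =
        r i (TensorProduct.equivFinsuppOfBasisRight b t k) := by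
    intro i t k
    induction t with
    | zero => simp
    | tmul x y => simp
    | add s t hs ht => rw [map_add, map_add, map_add, Finsupp.add_apply, Finsupp.add_apply,
        map_add, hs, ht]
  apply (TensorProduct.equivFinsuppOfBasisRight b).injective
  rw [map_zero]
  ext1 k
  refine hr _ fun i => ?_
  rw [← key, ht i, map_zero]
  rfl

theorem eq_zero_of_forall_id_mapL {E F ι : Type*} {F' : ι → Type*}
    [NormedAddCommGroup E] [InnerProductSpace ℂ E] [FiniteDimensional ℂ E]
    [NormedAddCommGroup F] [InnerProductSpace ℂ F]
    [∀ i, NormedAddCommGroup (F' i)] [∀ i, InnerProductSpace ℂ (F' i)]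
    {r : ∀ i, F →L[ℂ] F' i} (hr : ∀ x : F, (∀ i, r i x = 0) → x = 0) {t : E ⊗[ℂ] F}
    (ht : ∀ i, TensorProduct.mapL (ContinuousLinearMap.id ℂ E) (r i) t = 0) : t = 0 := by
  let b := Module.finBasis ℂ E
  have key : ∀ (i : ι) (t : E ⊗[ℂ] F) (k),
      TensorProduct.equivFinsuppOfBasisLeft b (TensorProduct.mapL (.id ℂ E) (r i) t) k =
        r i (TensorProduct.equivFinsuppOfBasisLeft b t k) := by
    intro i t k
    induction t with
    | zero => simp
    | tmul x y => simp
    | add s t hs ht => rw [map_add, map_add, map_add, Finsupp.add_apply, Finsupp.add_apply,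
        map_add, hs, ht]
  apply (TensorProduct.equivFinsuppOfBasisLeft b).injective
  rw [map_zero]
  ext1 k
  refine hr _ fun i => ?_
  rw [← key, ht i, map_zero]
  rfl

variable {E F E' F' G H : Type*}
  [NormedAddCommGroup E] [InnerProductSpace ℂ E] [FiniteDimensional ℂ E]
  [NormedAddCommGroup F] [InnerProductSpace ℂ F] [FiniteDimensional ℂ F]
  [NormedAddCommGroup E'] [InnerProductSpace ℂ E'] [FiniteDimensional ℂ E']
  [NormedAddCommGroup F'] [InnerProductSpace ℂ F'] [FiniteDimensional ℂ F']
  [NormedAddCommGroup G] [InnerProductSpace ℂ G] [NormedAddCommGroup H] [InnerProductSpace ℂ H]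

theorem mapL_comp_endTensor {f : (E →L[ℂ] E) →ₗ[ℂ] (E' →L[ℂ] E')}
    {g : (F →L[ℂ] F) →ₗ[ℂ] (F' →L[ℂ] F')} {r : E' →L[ℂ] E} {s : F' →L[ℂ] F}
    (hr : ∀ a, r ∘L f a = a ∘L r) (hs : ∀ b, s ∘L g b = b ∘L s)
    (z : E ⊗[ℂ] F →L[ℂ] E ⊗[ℂ] F) :
    TensorProduct.mapL r s ∘L endTensor f g z = z ∘L TensorProduct.mapL r s := by
  induction z using end_tensor_induction with
  | h0 => rw [map_zero, ContinuousLinearMap.comp_zero, ContinuousLinearMap.zero_comp]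
  | ha y z hy hz =>
    rw [map_add, ContinuousLinearMap.comp_add, ContinuousLinearMap.add_comp, hy, hz]
  | ht a b =>
    rw [endTensor_mapL, ← TensorProduct.mapL_comp, hr, hs, TensorProduct.mapL_comp]

theorem mapL_comp_endTensor_eq_zero {f : (E →L[ℂ] E) →ₗ[ℂ] (E' →L[ℂ] E')}
    {g : (F →L[ℂ] F) →ₗ[ℂ] (F' →L[ℂ] F')} {r : E' →L[ℂ] G} {s : F' →L[ℂ] H}
    (h : (∀ a, r ∘L f a = 0) ∨ ∀ b, s ∘L g b = 0) (z : E ⊗[ℂ] F →L[ℂ] E ⊗[ℂ] F) :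
    TensorProduct.mapL r s ∘L endTensor f g z = 0 := by
  induction z using end_tensor_induction with
  | h0 => rw [map_zero, ContinuousLinearMap.comp_zero]
  | ha y z hy hz => rw [map_add, ContinuousLinearMap.comp_add, hy, hz, add_zero]
  | ht a b =>
    rw [endTensor_mapL, ← TensorProduct.mapL_comp]
    rcases h with h | h
    · rw [h, TensorProduct.mapL_zero_left]
    · rw [h, TensorProduct.mapL_zero_right]

end tensor

namespace QRel

variable {X : QuantumSet.{u, v}} {Y : QuantumSet.{u', v'}} {X' : QuantumSet.{u'', v''}}
  {Y' : QuantumSet.{u₁, v₁}}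

theorem opTensor_mem_prod {R : QRel X Y} {S : QRel X' Y'} {p : (X.prod X').At}
    {q : (Y.prod Y').At} {r : X.space p.1 →L[ℂ] Y.space q.1} (hr : r ∈ R p.1 q.1)
    {s : X'.space p.2 →L[ℂ] Y'.space q.2} (hs : s ∈ S p.2 q.2) :
    opTensor (p := p) (q := q) r s ∈ R.prod S p q :=
  Submodule.subset_span ⟨r, hr, s, hs, rfl⟩

/-- Since r ⊗ s = (r ⊗ id)(id ⊗ s), the legs can be removed one at a time. -/
theorem Separating.prod {R : QRel X Y} {S : QRel X' Y'} (hR : R.Separating)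
    (hS : S.Separating) : (R.prod S).Separating := by
  intro p w hw
  have h2 : ∀ T : Σ j, S p.2 j, TensorProduct.mapL
      (ContinuousLinearMap.id ℂ (X.space p.1)) T.2.1 w = 0 := by
    intro T
    refine eq_zero_of_forall_mapL_id (ι := Σ j, R p.1 j) (E' := fun T => Y.space T.1)
      (r := fun T => T.2.1) (fun x hx => hR _ x fun j r hr => hx ⟨j, r, hr⟩) fun r => ?_
    have h3 := hw (show (Y.prod Y').At from (r.1, T.1)) _ (opTensor_mem_prod r.2.2 T.2.2)
    refine Eq.trans ?_ h3
    refine (ContinuousLinearMap.comp_apply _ _ _).symm.trans ?_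
    rw [← TensorProduct.mapL_comp, ContinuousLinearMap.id_comp, ContinuousLinearMap.comp_id]
    rfl
  exact eq_zero_of_forall_id_mapL (ι := Σ j, S p.2 j) (F' := fun T => Y'.space T.1)
    (r := fun T => T.2.1) (fun x hx => hS _ x fun j r hr => hx ⟨j, r, hr⟩) h2

theorem comp_block {ψ : LInf Y →⋆ₐ[ℂ] LInf X} {R : QRel X Y} (hR : R.Intertwines ψ) {i : X.At}
    {j : Y.At} {r : X.space i →L[ℂ] Y.space j} (hr : r ∈ R i j) (b : Y.space j →L[ℂ] Y.space j) :
    r ∘L block ψ i j b = b ∘L r := by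
  rw [block_apply, ← hR i j r hr, LInf.single_self]

theorem comp_block_ne {ψ : LInf Y →⋆ₐ[ℂ] LInf X} {R : QRel X Y} (hR : R.Intertwines ψ)
    {i : X.At} {j k : Y.At} (h : j ≠ k) {r : X.space i →L[ℂ] Y.space j} (hr : r ∈ R i j)
    (b : Y.space k →L[ℂ] Y.space k) : r ∘L block ψ i k b = 0 := by
  rw [block_apply, ← hR i j r hr, LInf.single_ne h, ContinuousLinearMap.zero_comp]

/-- An operator r ⊗ s into the atom `q` annihilates every term of the finite sum defining
`tensorHom` except the one indexed by `q`, where the identity is checked on elementary tensors. -/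
theorem Intertwines.prod {R : QRel X Y} {S : QRel X' Y'} {ψ : LInf Y →⋆ₐ[ℂ] LInf X}
    {ψ' : LInf Y' →⋆ₐ[ℂ] LInf X'} (hR : R.Intertwines ψ) (hS : S.Intertwines ψ') :
    (R.prod S).Intertwines (tensorHom ψ ψ') := by
  intro p q T hT x
  induction hT using Submodule.span_induction with
  | zero => rw [ContinuousLinearMap.comp_zero, ContinuousLinearMap.zero_comp]
  | add S T _ _ hS hT => rw [ContinuousLinearMap.comp_add, ContinuousLinearMap.add_comp, hS, hT]
  | smul c T _ hT => rw [ContinuousLinearMap.comp_smul, ContinuousLinearMap.smul_comp, hT]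
  | mem T hT =>
    obtain ⟨r, hr, s, hs, rfl⟩ := hT
    have hq : ∀ z, opTensor (p := p) (q := q) r s ∘L blockTensor ψ ψ' p q z =
        z ∘L opTensor (p := p) (q := q) r s :=
      fun z => mapL_comp_endTensor (comp_block hR hr) (comp_block hS hs) z
    have hne : ∀ q' ≠ q, ∀ z,
        opTensor (p := p) (q := q) r s ∘L blockTensor ψ ψ' p q' z = 0 := by
      intro q' hq' z
      refine mapL_comp_endTensor_eq_zero ?_ z
      by_cases h : q.1 = q'.1
      · exact Or.inr (comp_block_ne hS (fun h2 => hq' (Prod.ext h.symm h2.symm)) hs)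
      · exact Or.inl (comp_block_ne hR h hr)
    have hsum : opTensor (p := p) (q := q) r s ∘L tensorHom ψ ψ' x p =
        ∑ q' ∈ (blockTensor_finite ψ ψ' p).toFinset,
          opTensor (p := p) (q := q) r s ∘L blockTensor ψ ψ' p q' (x q') :=
      (congrArg (fun z => opTensor (p := p) (q := q) r s ∘L z)
        (finsum_eq_sum_of_support_subset _ (blockTensor_support ψ ψ' p x))).trans
        (ContinuousLinearMap.comp_finsetSum ..)
    refine (hsum.trans ((Finset.sum_eq_single q (fun q' _ hq' => hne q' hq' _) fun h => ?_).trans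
      (hq _))).symm
    have h0 : blockTensor ψ ψ' p q = 0 := by simpa using h
    have h1 : blockTensor ψ ψ' p q (x q) = 0 := DFunLike.congr_fun h0 (x q)
    exact (congrArg (fun z => opTensor (p := p) (q := q) r s ∘L z) h1).trans
      (ContinuousLinearMap.comp_zero _)

end QRel

/-! ### Functionals, Riesz vectors and the eigenvalue equation -/

theorem mem_of_forall_apply_eq_zero {H : Type*} [NormedAddCommGroup H] [NormedSpace ℂ H]
    [FiniteDimensional ℂ H] {W : Submodule ℂ (H →L[ℂ] ℂ)} {f : H →L[ℂ] ℂ}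
    (h : ∀ x, (∀ w ∈ W, w x = 0) → f x = 0) : f ∈ W := by
  let e : (H →L[ℂ] ℂ) ≃ₗ[ℂ] Module.Dual ℂ H := LinearMap.toContinuousLinearMap.symm
  have h1 : e f ∈ (W.map e.toLinearMap).dualCoannihilator.dualAnnihilator := by
    rw [Submodule.mem_dualAnnihilator]
    intro x hx
    refine h x fun w hw => ?_
    exact (Submodule.mem_dualCoannihilator x).mp hx (e w) (Submodule.mem_map_of_mem hw)
  rw [Subspace.dualCoannihilator_dualAnnihilator_eq] at h1
  obtain ⟨w, hw, hwf⟩ := h1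
  rwa [← e.injective hwf]

/-- The vector representing a linear functional on an atom. -/
def rieszVector {H : Type*} [NormedAddCommGroup H] [InnerProductSpace ℂ H]
    [FiniteDimensional ℂ H] [CompleteSpace H] (g : H →ₗ[ℂ] ℂ) : H :=
  (InnerProductSpace.toDual ℂ H).symm (LinearMap.toContinuousLinearMap g)

section riesz

variable {H : Type*} [NormedAddCommGroup H] [InnerProductSpace ℂ H]
    [FiniteDimensional ℂ H] [CompleteSpace H]

theorem inner_rieszVector (g : H →ₗ[ℂ] ℂ) (w : H) : ⟪rieszVector g, w⟫_ℂ = g w :=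
  InnerProductSpace.toDual_symm_apply

theorem rieszVector_ne_zero {g : H →ₗ[ℂ] ℂ} (hg : g ≠ 0) : rieszVector g ≠ 0 := by
  intro h
  apply hg
  ext w
  rw [← inner_rieszVector, h, inner_zero_left, LinearMap.zero_apply]

theorem adjoint_toContinuousLinearMap_apply (g : H →ₗ[ℂ] ℂ) (c : ℂ) :
    ContinuousLinearMap.adjoint (LinearMap.toContinuousLinearMap g) c = c • rieszVector g := by
  refine ext_inner_right ℂ fun w => ?_
  rw [ContinuousLinearMap.adjoint_inner_left, inner_smul_left, inner_rieszVector, RCLike.inner_apply]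
  exact mul_comm _ _

end riesz

/-- The functionals `g p` on the atoms of `Y` are eigenvectors of the operators `Ψ(a)` acting from
the right, with the eigenvalues given by the character `ε`. -/
def IsEigenfunctional {X : QuantumSet.{u, v}} {Y : QuantumSet.{u', v'}} (Ψ : LInf X → LInf Y)
    (ε : LInf X →⋆ₐ[ℂ] ℂ) (g : ∀ p, Y.space p →ₗ[ℂ] ℂ) : Prop :=
  ∀ a p w, g p (Ψ a p w) = ε a * g p w

section

variable {X : QuantumSet.{u, v}} {Y : QuantumSet.{u', v'}} {Ψ : LInf X → LInf Y}
  {ε : LInf X →⋆ₐ[ℂ] ℂ} {g : ∀ p, Y.space p →ₗ[ℂ] ℂ}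

/-- Take adjoints and replace `a` by `star a`; both Ψ and ε respect the involution. -/
theorem isEigenfunctional_iff (hΨ : ∀ a, Ψ (star a) = star (Ψ a)) :
    IsEigenfunctional Ψ ε g ↔
      ∀ a p, Ψ a p (rieszVector (g p)) = ε a • rieszVector (g p) := by
  constructor
  · intro h a p
    refine ext_inner_right ℂ fun w => ?_
    have h1 := h (star a) p w
    rw [hΨ, LInf.star_apply, ContinuousLinearMap.star_eq_adjoint, ← inner_rieszVector,
      ContinuousLinearMap.adjoint_inner_right, map_star] at h1
    rw [h1, inner_smul_left, inner_rieszVector]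
    rfl
  · intro h a p w
    have h1 := h (star a) p
    rw [hΨ, LInf.star_apply, ContinuousLinearMap.star_eq_adjoint, map_star] at h1
    rw [← inner_rieszVector, ← ContinuousLinearMap.adjoint_inner_left, h1, inner_smul_left,
      inner_rieszVector]
    simp

end

theorem apply_eq_smul_apply_one {E : Type*} [NormedAddCommGroup E] [NormedSpace ℂ E]
    (r : ℂ →L[ℂ] E) (c : ℂ) : r c = c • r 1 := by
  rw [← map_smul, smul_eq_mul, mul_one]

/-! ### The eigenvalue equation in terms of relations -/

namespace QRel

variable {X : QuantumSet.{u, v}} {Y : QuantumSet.{u', v'}} {Z : QuantumSet.{u'', v''}}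

theorem comp_mem {S : QRel Y Z} {R : QRel X Y} {i j k} {s : Y.space j →L[ℂ] Z.space k}
    (hs : s ∈ S j k) {r : X.space i →L[ℂ] Y.space j} (hr : r ∈ R i j) :
    s ∘L r ∈ S.comp R i k :=
  Submodule.subset_span ⟨j, s, hs, r, hr, rfl⟩

theorem adjoint_mem_dagger {R : QRel X Y} {i j} {r : X.space i →L[ℂ] Y.space j}
    (hr : r ∈ R i j) : ContinuousLinearMap.adjoint r ∈ R.dagger j i :=
  Submodule.subset_span ⟨r, hr, rfl⟩

/-- The relation from `Y` to the unit spanned by a functional on each atom. -/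
def ofFunctional (g : ∀ p, Y.space p →ₗ[ℂ] ℂ) : QRel Y QuantumSet.one := fun p _ =>
  Submodule.span ℂ {LinearMap.toContinuousLinearMap (g p)}

theorem mem_hat_scalar_iff {ε : LInf X →⋆ₐ[ℂ] ℂ} {o : QuantumSet.one.At} {k : X.At}
    {T : QuantumSet.one.space o →L[ℂ] X.space k} :
    T ∈ hat (scalarIso.comp ε) o k ↔ ∀ a : LInf X, a k ∘L T = ε a • T := by
  refine forall_congr' fun a => ?_
  have : T ∘L (scalarIso.comp ε) a o = ε a • T := by
    refine ContinuousLinearMap.ext fun c : ℂ => ?_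
    change T (ε a • c) = ε a • T c
    exact map_smul _ _ _
  rw [this]

theorem comp_of_mem_dagger_hat {ψ : LInf Y →⋆ₐ[ℂ] LInf X} {i : X.At} {j : Y.At}
    {S : Y.space j →L[ℂ] X.space i} (hS : S ∈ (hat ψ).dagger j i) (a : LInf Y) :
    S ∘L a j = ψ a i ∘L S := by
  induction hS using Submodule.span_induction with
  | zero => rw [ContinuousLinearMap.comp_zero, ContinuousLinearMap.zero_comp]
  | add S T _ _ hS hT => rw [ContinuousLinearMap.comp_add, ContinuousLinearMap.add_comp, hS, hT]
  | smul c T _ hT => rw [ContinuousLinearMap.comp_smul, ContinuousLinearMap.smul_comp, hT]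
  | mem S hS =>
    obtain ⟨r, hr, rfl⟩ := hS
    have h := congrArg ContinuousLinearMap.adjoint (hr (star a))
    rw [ContinuousLinearMap.adjoint_comp, ContinuousLinearMap.adjoint_comp, map_star,
      LInf.star_apply, LInf.star_apply, ContinuousLinearMap.star_eq_adjoint,
      ContinuousLinearMap.star_eq_adjoint, ContinuousLinearMap.adjoint_adjoint,
      ContinuousLinearMap.adjoint_adjoint] at h
    exact h

theorem toSpanSingleton_mem_hat_scalar {ε : LInf X →⋆ₐ[ℂ] ℂ} {k : X.At} {x : X.space k}
    (hx : ∀ a : LInf X, a k x = ε a • x) (o : QuantumSet.one.At) :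
    (ContinuousLinearMap.toSpanSingleton ℂ x : ℂ →L[ℂ] X.space k) ∈
      hat (scalarIso.comp ε) o k := by
  refine mem_hat_scalar_iff.mpr fun a => ContinuousLinearMap.ext fun c : ℂ => ?_
  change a k (c • x) = ε a • c • x
  rw [map_smul, hx, smul_comm]

section character

variable {ε : LInf X →⋆ₐ[ℂ] ℂ} {k : X.At} {x : X.space k}

/-- The operator |y⟩⟨x| on the atom sends `x` to a nonzero multiple of `y`, yet must act on `x` as a
scalar. So the atom is a line. -/
theorem exists_smul_eq_of_eigenvector (hx : ∀ a : LInf X, a k x = ε a • x) (h0 : x ≠ 0)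
    (y : X.space k) : ∃ c : ℂ, y = c • x := by
  have h := hx (LInf.single k (InnerProductSpace.rankOne ℂ y x))
  rw [LInf.single_self, InnerProductSpace.rankOne_apply] at h
  refine ⟨(⟪x, x⟫_ℂ)⁻¹ * ε (LInf.single k (InnerProductSpace.rankOne ℂ y x)), ?_⟩
  rw [mul_smul, ← h, inv_smul_smul₀ (inner_self_ne_zero.mpr h0)]

/-- This pins down the atom on which ε lives: the central projection of `k` acts as zero on every
other atom. -/
theorem character_single_one (hx : ∀ a : LInf X, a k x = ε a • x) (h0 : x ≠ 0) :
    ε (LInf.single k 1) = 1 := by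
  have h := hx (LInf.single k 1)
  rw [LInf.single_self, one_apply_eq_self] at h
  exact smul_left_injective ℂ h0 (h.symm.trans (one_smul ℂ x).symm)

end character

variable {Ψ : LInf X → LInf Y} {ε : LInf X →⋆ₐ[ℂ] ℂ} {g : ∀ p, Y.space p →ₗ[ℂ] ℂ}
  {R : QRel Y X}

/-- Intertwiners carry the Riesz vector to ε-eigenvectors; separation prevents all of them from
vanishing. -/
theorem exists_eigenvector (hΨ : ∀ a, Ψ (star a) = star (Ψ a)) (hR : R.Intertwines Ψ)
    (hs : R.Separating) (h : IsEigenfunctional Ψ ε g) {p : Y.At} (hp : g p ≠ 0) :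
    ∃ k, ∃ T ∈ R p k, T (rieszVector (g p)) ≠ 0 ∧
      ∀ a : LInf X, a k (T (rieszVector (g p))) = ε a • T (rieszVector (g p)) := by
  by_contra! hc
  refine rieszVector_ne_zero hp (hs p _ fun k T hT => ?_)
  by_contra h0
  obtain ⟨a, ha⟩ := hc k T hT h0
  apply ha
  have h1 := DFunLike.congr_fun (hR p k T hT a) (rieszVector (g p))
  rw [ContinuousLinearMap.comp_apply, ContinuousLinearMap.comp_apply,
    (isEigenfunctional_iff hΨ).mp h, map_smul] at h1
  exact h1

theorem ofFunctional_le_of_isEigenfunctional (hΨ : ∀ a, Ψ (star a) = star (Ψ a))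
    (hR : R.Intertwines Ψ) (hs : R.Separating) (h : IsEigenfunctional Ψ ε g) :
    ofFunctional g ≤ (hat (scalarIso.comp ε)).dagger.comp R := by
  intro p o
  refine (Submodule.span_singleton_le_iff_mem _ _).mpr ?_
  by_cases hp : g p = 0
  · rw [hp, map_zero]
    exact Submodule.zero_mem _
  obtain ⟨k, T₀, -, hx0, hx⟩ := exists_eigenvector hΨ hR hs h hp
  generalize T₀ (rieszVector (g p)) = x at hx0 hx
  -- By the double annihilator, it suffices that `g p` vanishes wherever all functionals of the
  -- composite do. Such a `w` satisfies Ψ(1_k)w = 0, and ε(1_k) = 1 then forces `g p w = 0`.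
  refine mem_of_forall_apply_eq_zero fun w hw => ?_
  have h1 : Ψ (LInf.single k 1) p w = 0 := by
    refine hs p _ fun l T hT => ?_
    have h2 := DFunLike.congr_fun (hR p l T hT (LInf.single k 1)) w
    rw [ContinuousLinearMap.comp_apply, ContinuousLinearMap.comp_apply] at h2
    rw [← h2]
    by_cases hl : l = k
    · subst hl
      rw [LInf.single_self, one_apply_eq_self]
      have h3 : ContinuousLinearMap.adjoint
          (ContinuousLinearMap.toSpanSingleton ℂ x : ℂ →L[ℂ] X.space l) (T w) = 0 :=
        hw _ (comp_mem (adjoint_mem_dagger (toSpanSingleton_mem_hat_scalar hx o)) hT)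
      have h4 : ⟪x, T w⟫_ℂ = 0 := by
        have h5 := ContinuousLinearMap.adjoint_inner_right
          (ContinuousLinearMap.toSpanSingleton ℂ x : ℂ →L[ℂ] X.space l) 1 (T w)
        rw [h3, inner_zero_right, ContinuousLinearMap.toSpanSingleton_apply, one_smul] at h5
        exact h5.symm
      -- The atom is the line of `x`, so orthogonality of `T w` to `x` makes it zero.
      obtain ⟨c, hc⟩ := exists_smul_eq_of_eigenvector hx hx0 (T w)
      rw [hc, inner_smul_right, mul_eq_zero] at h4
      rw [hc, h4.resolve_right (inner_self_ne_zero.mpr hx0), zero_smul]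
    · rw [LInf.single_ne hl, zero_apply]
  have h6 := h (LInf.single k 1) p w
  rw [h1, map_zero, character_single_one hx hx0, one_mul] at h6
  exact h6.symm

/-- Every functional of the composite satisfies the equation: Ψ(a) slides through R to become `a`,
and then through ε̂† to become the scalar ε(a). -/
theorem isEigenfunctional_of_ofFunctional_le (hR : R.Intertwines Ψ)
    (h : ofFunctional g ≤ (hat (scalarIso.comp ε)).dagger.comp R) :
    IsEigenfunctional Ψ ε g := by
  intro a p w
  let o : QuantumSet.one.At := ()
  have key : ∀ f ∈ (hat (scalarIso.comp ε)).dagger.comp R p o, f (Ψ a p w) = ε a • f w := by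
    intro f hf
    induction hf using Submodule.span_induction with
    | zero => rw [zero_apply, zero_apply, smul_zero]
    | add S T _ _ hS hT => rw [add_apply, add_apply, smul_add, hS, hT]
    | smul c T _ hT => rw [smul_apply, smul_apply, hT, smul_comm]
    | mem f hf =>
      obtain ⟨k, s, hs, T, hT, rfl⟩ := hf
      have h1 := DFunLike.congr_fun (hR p k T hT a) w
      rw [ContinuousLinearMap.comp_apply, ContinuousLinearMap.comp_apply] at h1
      have h2 := DFunLike.congr_fun (comp_of_mem_dagger_hat hs a) (T w)
      rw [ContinuousLinearMap.comp_apply, ContinuousLinearMap.comp_apply] at h2 ⊢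
      rw [← h1, h2]
      rfl
  exact key _ (h p o (Submodule.mem_span_singleton_self _))

/-- All operators of R kill Ψ(a)t - ε(a)t, because they send t to ε-eigenvectors; separation
concludes. -/
theorem isEigenfunctional_of_comp_dagger_eq (hΨ : ∀ a, Ψ (star a) = star (Ψ a))
    (hR : R.Intertwines Ψ) (hs : R.Separating)
    (h : R.comp (ofFunctional g).dagger = hat (scalarIso.comp ε)) :
    IsEigenfunctional Ψ ε g := by
  rw [isEigenfunctional_iff hΨ]
  intro a p
  rw [← sub_eq_zero]
  refine hs p _ fun k T hT => ?_
  let o : QuantumSet.one.At := ()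
  have h1 : T ∘L ContinuousLinearMap.adjoint (LinearMap.toContinuousLinearMap (g p)) ∈
      hat (scalarIso.comp ε) o k := by
    rw [← h]
    exact comp_mem hT (adjoint_mem_dagger (Submodule.mem_span_singleton_self _))
  have h2 : a k (T (ContinuousLinearMap.adjoint (LinearMap.toContinuousLinearMap (g p)) 1)) =
      ε a • T (ContinuousLinearMap.adjoint (LinearMap.toContinuousLinearMap (g p)) 1) :=
    DFunLike.congr_fun (mem_hat_scalar_iff.mp h1 a) (1 : ℂ)
  rw [adjoint_toContinuousLinearMap_apply, one_smul] at h2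
  have h3 := DFunLike.congr_fun (hR p k T hT a) (rieszVector (g p))
  rw [ContinuousLinearMap.comp_apply, ContinuousLinearMap.comp_apply] at h3
  rw [map_sub, ← h3, h2, map_smul, sub_self]

/-- The nontrivial inclusion holds because ε̂ lives on a single atom, which is a line. A nonzero `g
p` yields a vector T t spanning that line. -/
theorem comp_dagger_eq_of_isEigenfunctional (hΨ : ∀ a, Ψ (star a) = star (Ψ a))
    (hR : R.Intertwines Ψ) (hs : R.Separating) (hg : ∃ p, g p ≠ 0)
    (h : IsEigenfunctional Ψ ε g) :
    R.comp (ofFunctional g).dagger = hat (scalarIso.comp ε) := by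
  funext o k
  refine le_antisymm (Submodule.span_le.mpr ?_) ?_
  · rintro _ ⟨p, T, hT, S, hS, rfl⟩
    refine mem_hat_scalar_iff.mpr fun a => ?_
    have h1 : Ψ a p ∘L S = ε a • S := by
      induction hS using Submodule.span_induction with
      | zero => rw [ContinuousLinearMap.comp_zero, smul_zero]
      | add S T _ _ hS hT => rw [ContinuousLinearMap.comp_add, smul_add, hS, hT]
      | smul c T _ hT => rw [ContinuousLinearMap.comp_smul, hT, smul_comm]
      | mem S hS =>
        obtain ⟨r, hr, rfl⟩ := hS
        obtain ⟨c, rfl⟩ := Submodule.mem_span_singleton.mp hr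
        refine ContinuousLinearMap.ext fun d : ℂ => ?_
        have h2 : ContinuousLinearMap.adjoint
            (c • LinearMap.toContinuousLinearMap (g p)) (d : ℂ) =
              (starRingEnd ℂ c * d) • rieszVector (g p) := by
          rw [map_smulₛₗ, smul_apply, adjoint_toContinuousLinearMap_apply, mul_smul]
        change Ψ a p (ContinuousLinearMap.adjoint
            (c • LinearMap.toContinuousLinearMap (g p)) (d : ℂ)) =
          ε a • (ContinuousLinearMap.adjoint
            (c • LinearMap.toContinuousLinearMap (g p)) (d : ℂ))
        rw [h2, map_smul, (isEigenfunctional_iff hΨ).mp h, smul_comm]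
    rw [← ContinuousLinearMap.comp_assoc, hR p k T hT, ContinuousLinearMap.comp_assoc, h1,
      ContinuousLinearMap.comp_smul]
  · intro r hr
    obtain ⟨p, hp⟩ := hg
    obtain ⟨l, T, hT, hx0, hx⟩ := exists_eigenvector hΨ hR hs h hp
    have hr1 : ∀ a : LInf X, a k (r (1 : ℂ)) = ε a • r (1 : ℂ) := fun a =>
      DFunLike.congr_fun (mem_hat_scalar_iff.mp hr a) (1 : ℂ)
    by_cases hkl : k = l
    · subst hkl
      obtain ⟨c, hc⟩ := exists_smul_eq_of_eigenvector hx hx0 (r (1 : ℂ))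
      have hrT : r = c • (T ∘L
          ContinuousLinearMap.adjoint (LinearMap.toContinuousLinearMap (g p))) := by
        refine ContinuousLinearMap.ext fun d : ℂ => ?_
        have h3 : r d = d • r (1 : ℂ) := apply_eq_smul_apply_one r d
        rw [h3, hc]
        change d • c • T (rieszVector (g p)) = c • T (ContinuousLinearMap.adjoint
          (LinearMap.toContinuousLinearMap (g p)) (d : ℂ))
        rw [adjoint_toContinuousLinearMap_apply, map_smul, smul_comm]
      rw [hrT]
      exact Submodule.smul_mem _ _ (comp_mem hT
        (adjoint_mem_dagger (Submodule.mem_span_singleton_self _)))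
    -- Away from `l`, the central projection of `l` acts as 0 but has ε-value 1.
    · have h4 := hr1 (LInf.single l 1)
      rw [LInf.single_ne hkl, zero_apply, character_single_one hx hx0, one_smul] at h4
      have hr0 : r = 0 := by
        refine ContinuousLinearMap.ext fun d : ℂ => ?_
        have h3 : r d = d • r (1 : ℂ) := apply_eq_smul_apply_one r d
        rw [h3, ← h4, smul_zero]
        rfl
      rw [hr0]
      exact Submodule.zero_mem _

end QRel

/-! ### Positive functionals and Cauchy–Schwarz -/

section positive

variable {A : Type*} [Ring A] [StarRing A] [Algebra ℂ A] [StarModule ℂ A] {φ : A →ₗ[ℂ] ℂ}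

/-- Polarization: φ is real on the squares of 1, x, 1 + x and 1 + ix. -/
theorem map_star_of_nonneg (hφ : ∀ a, 0 ≤ φ (star a * a)) (x : A) :
    φ (star x) = starRingEnd ℂ (φ x) := by
  have him : ∀ a, (φ (star a * a)).im = 0 := fun a => (Complex.nonneg_iff.mp (hφ a)).2.symm
  have h1 := him (1 + x)
  have h2 := him (1 + Complex.I • x)
  have h3 := him x
  have h4 := him 1
  simp only [star_add, star_one, star_smul, add_mul, mul_add, one_mul, mul_one, map_add,
    smul_mul_assoc, mul_smul_comm, map_smul, Complex.star_def, Complex.conj_I, smul_eq_mul,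
    Complex.add_im, Complex.mul_im, Complex.I_re, Complex.I_im, Complex.neg_im,
    Complex.neg_re, Complex.mul_re] at h1 h2 h4
  apply Complex.ext
  · rw [Complex.conj_re]; linarith
  · rw [Complex.conj_im]; linarith

theorem cauchySchwarz_of_nonneg (hφ : ∀ a, 0 ≤ φ (star a * a)) (a b : A) :
    ‖φ (star a * b)‖ ^ 2 ≤ (φ (star a * a)).re * (φ (star b * b)).re := by
  let c : PreInnerProductSpace.Core ℂ A :=
    { inner := fun a b => φ (star a * b)
      conj_inner_symm := fun x y => by
        rw [← map_star_of_nonneg hφ, star_mul, star_star]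
      re_inner_nonneg := fun x => (Complex.nonneg_iff.mp (hφ x)).1
      add_left := fun x y z => by rw [star_add, add_mul, map_add]
      smul_left := fun x y r => by rw [star_smul, smul_mul_assoc, map_smul]; rfl }
  have h1 := @InnerProductSpace.Core.inner_mul_inner_self_le ℂ A _ _ _ c a b
  have h2 : ‖φ (star b * a)‖ = ‖φ (star a * b)‖ := by
    rw [← RCLike.norm_conj, ← map_star_of_nonneg hφ, star_mul, star_star]
  change ‖φ (star a * b)‖ * ‖φ (star b * a)‖ ≤ _ at h1
  rw [h2, ← sq] at h1
  exact h1

theorem map_mul_eq_zero_of_isStarProjection (hφ : ∀ a, 0 ≤ φ (star a * a)) {z : A}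
    (hz : IsStarProjection z) (h0 : φ z = 0) (x : A) : φ (z * x) = 0 := by
  have h := cauchySchwarz_of_nonneg hφ z x
  rw [hz.isSelfAdjoint.star_eq, hz.isIdempotentElem.eq, h0, Complex.zero_re, zero_mul] at h
  simpa using le_antisymm h (sq_nonneg _)

end positive

/-! ### Normal states and vector states -/

section normal

variable {X : QuantumSet.{u, v}} {Y : QuantumSet.{u', v'}} {φ : LInf Y →ₗ[ℂ] ℂ}

/-- A normal state is determined by its restrictions to the factors. -/
theorem IsNormalState.eq_zero_of_single (hφ : IsNormalState φ) {y : LInf Y}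
    (hy : ∀ p, φ (LInf.single p (y p)) = 0) : φ y = 0 := by
  by_contra h0
  have hF : ∀ F, φ (y * LInf.trunc F) = 0 := by
    intro F
    rw [LInf.trunc, Finset.mul_sum, map_sum]
    refine Finset.sum_eq_zero fun p _ => ?_
    rw [LInf.mul_single, mul_one, hy]
  set C := (φ (star (star y) * star y)).re with hC
  -- Cauchy–Schwarz applied to φ(y) = φ(y(1 - trunc F)).
  have hbound : ∀ F, ‖φ y‖ ^ 2 ≤ C * (1 - (φ (LInf.trunc F)).re) := by
    intro F
    have hP := (LInf.isStarProjection_trunc F).one_sub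
    have h := cauchySchwarz_of_nonneg hφ.nonneg (star y) (1 - LInf.trunc F)
    rw [hP.isSelfAdjoint.star_eq, hP.isIdempotentElem.eq, star_star, mul_sub, mul_one, map_sub,
      hF, sub_zero, map_sub, hφ.map_one, Complex.sub_re, Complex.one_re] at h
    rwa [hC, star_star]
  have hpos : 0 < ‖φ y‖ ^ 2 := by positivity
  have hC0 : 0 < C := by
    have h1 : 0 ≤ C := (Complex.nonneg_iff.mp (hφ.nonneg (star y))).1
    rcases h1.eq_or_lt with h1 | h1
    · have := hbound ∅
      rw [← h1, zero_mul] at this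
      exact absurd this (not_le.mpr hpos)
    · exact h1
  -- If φ(y) ≠ 0, the bound keeps all φ(trunc F) uniformly below 1, while normality makes their
  -- supremum φ(1) = 1.
  have hsup := (LInf.isStarSup_image_trunc hφ.normal).2
    ((1 - ‖φ y‖ ^ 2 / C : ℝ) : ℂ) (by
      rintro _ ⟨_, ⟨F, rfl⟩, rfl⟩
      rw [starLE_complex_iff]
      have hP := LInf.isStarProjection_trunc F
      have h1 := hφ.nonneg (LInf.trunc F)
      rw [hP.isSelfAdjoint.star_eq, hP.isIdempotentElem.eq] at h1
      refine Complex.le_def.mpr ⟨?_, ?_⟩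
      · rw [Complex.ofReal_re]
        have h2 : ‖φ y‖ ^ 2 / C ≤ 1 - (φ (LInf.trunc F)).re := by
          rw [div_le_iff₀ hC0, mul_comm]
          exact hbound F
        linarith
      · rw [Complex.ofReal_im]
        exact (Complex.nonneg_iff.mp h1).2.symm)
  rw [starLE_complex_iff, hφ.map_one] at hsup
  have h2 := (Complex.le_def.mp hsup).1
  rw [Complex.ofReal_re, Complex.one_re] at h2
  have h3 : 0 < ‖φ y‖ ^ 2 / C := by positivity
  linarith

/-- On each atom Ψ(a) - ε(a) has range in ker g, so it is a sum of rank-one operators that φ kills.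
-/
theorem IsNormalState.apply_eq_of_isEigenfunctional (hφ : IsNormalState φ)
    {Ψ : LInf X → LInf Y} {ε : LInf X →⋆ₐ[ℂ] ℂ} {g : ∀ p, Y.space p →ₗ[ℂ] ℂ}
    (hg : ∀ p w, g p w = 0 → ∀ x, φ (LInf.single p (InnerProductSpace.rankOne ℂ w x)) = 0)
    (h : IsEigenfunctional Ψ ε g) (a : LInf X) : φ (Ψ a) = ε a := by
  have key : φ (Ψ a - ε a • 1) = 0 := by
    refine hφ.eq_zero_of_single fun p => ?_
    let b := stdOrthonormalBasis ℂ (Y.space p)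
    have hsum : ∀ T : Y.space p →L[ℂ] Y.space p,
        T = ∑ k, InnerProductSpace.rankOne ℂ (T (b k)) (b k) := fun T => by
      conv_lhs => rw [← ContinuousLinearMap.comp_id T, ← b.sum_rankOne_eq_id,
        ContinuousLinearMap.comp_finsetSum]
      exact Finset.sum_congr rfl fun k _ => InnerProductSpace.comp_rankOne _ _ _
    rw [hsum ((Ψ a - ε a • 1) p), LInf.single_sum, map_sum]
    refine Finset.sum_eq_zero fun k _ => hg p _ ?_ _
    rw [LInf.sub_apply, LInf.smul_apply, LInf.one_apply, sub_apply, smul_apply,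
      one_apply_eq_self, map_sub, h, map_smul, smul_eq_mul, sub_self]
  rw [map_sub, map_smul, hφ.map_one, smul_eq_mul, mul_one, sub_eq_zero] at key
  exact key

/-- The functional `x ↦ ⟨e, x_p e⟩`. -/
def vectorFunctional (p : Y.At) (e : Y.space p) : LInf Y →ₗ[ℂ] ℂ where
  toFun x := ⟪e, x p e⟫_ℂ
  map_add' x y := by rw [LInf.add_apply, add_apply, inner_add_right]
  map_smul' c x := by
    rw [LInf.smul_apply, smul_apply, inner_smul_right]
    rfl

theorem vectorFunctional_apply (p : Y.At) (e : Y.space p) (x : LInf Y) :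
    vectorFunctional p e x = ⟪e, x p e⟫_ℂ := rfl

theorem starLE_iff_le {E : Type*} [NormedAddCommGroup E] [InnerProductSpace ℂ E]
    [CompleteSpace E] {a b : E →L[ℂ] E} : StarLE a b ↔ a ≤ b := starLE_iff_isPositive

theorem inner_apply_le_of_le {E : Type*} [NormedAddCommGroup E] [InnerProductSpace ℂ E]
    [CompleteSpace E] {a b : E →L[ℂ] E} (h : a ≤ b) (e : E) : ⟪e, a e⟫_ℂ ≤ ⟪e, b e⟫_ℂ := by
  rw [← sub_nonneg, ← inner_sub_right, ← sub_apply]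
  exact ((ContinuousLinearMap.le_def a b).mp h).inner_nonneg_right e

theorem isCompact_Icc_operator {E : Type*} [NormedAddCommGroup E] [InnerProductSpace ℂ E]
    [FiniteDimensional ℂ E] [CompleteSpace E] (a b : E →L[ℂ] E) : IsCompact (Set.Icc a b) := by
  have : ProperSpace (E →L[ℂ] E) := FiniteDimensional.proper ℂ _
  refine Metric.isCompact_of_isClosed_isBounded isClosed_Icc
    ((Metric.isBounded_closedBall (x := a) (r := ‖b - a‖)).subset fun z hz => ?_)
  rw [Metric.mem_closedBall, dist_eq_norm]
  exact CStarAlgebra.norm_le_norm_of_nonneg_of_le (sub_nonneg.mpr hz.1)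
    (sub_le_sub_right hz.2 a)

/-- A compactness argument in the finite-dimensional atom: given an upper bound `r` of the values,
the order intervals from d_p to x_p, cut by ⟨e, z e⟩ ≤ r, have a common point `z`. -/
theorem isNormalMap_vectorFunctional (p : Y.At) (e : Y.space p) :
    IsNormalMap (vectorFunctional p e) := by
  classical
  intro D x hne _ hdir hsup
  have hle : ∀ d ∈ D, d p ≤ x p := fun d hd => starLE_iff_le.mp (LInf.starLE_apply (hsup.1 d hd) p)
  refine ⟨?_, fun r hr => ?_⟩
  · rintro _ ⟨d, hd, rfl⟩
    exact starLE_complex_iff.mpr (inner_apply_le_of_le (hle d hd) e)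
  · have : Nonempty D := hne.to_subtype
    let K : D → Set (Y.space p →L[ℂ] Y.space p) := fun d =>
      Set.Icc (d.1 p) (x p) ∩ {z | ⟪e, z e⟫_ℂ ≤ r}
    have hcl : IsClosed {z : Y.space p →L[ℂ] Y.space p | ⟪e, z e⟫_ℂ ≤ r} :=
      isClosed_le (by fun_prop) continuous_const
    obtain ⟨z, hz⟩ := IsCompact.nonempty_iInter_of_directed_nonempty_isCompact_isClosed K
      (by
        rintro ⟨d, hd⟩ ⟨d', hd'⟩
        obtain ⟨f, hf, h1, h2⟩ := hdir d hd d' hd'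
        refine ⟨⟨f, hf⟩, ?_, ?_⟩
        · exact Set.inter_subset_inter_left _
            (Set.Icc_subset_Icc_left (starLE_iff_le.mp (LInf.starLE_apply h1 p)))
        · exact Set.inter_subset_inter_left _
            (Set.Icc_subset_Icc_left (starLE_iff_le.mp (LInf.starLE_apply h2 p))))
      (fun d => ⟨d.1 p, ⟨le_rfl, hle _ d.2⟩, starLE_complex_iff.mp (hr _ ⟨d, d.2, rfl⟩)⟩)
      (fun d => (isCompact_Icc_operator _ _).inter_right hcl)
      (fun d => isClosed_Icc.inter hcl)
    rw [Set.mem_iInter] at hz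
    -- Replacing the `p`-entry of `x` by `z` still bounds `D` from above, so x_p ≤ z by leastness of
    -- `x`.
    have hzx : StarLE x (x + LInf.single p (z - x p)) := by
      refine hsup.2 _ fun d hd => LInf.starLE_of_apply fun q => ?_
      by_cases hq : q = p
      · subst hq
        rw [LInf.add_apply, LInf.single_self, add_sub_cancel]
        exact starLE_iff_le.mpr (hz ⟨d, hd⟩).1.1
      · rw [LInf.add_apply, LInf.single_ne hq, add_zero]
        exact LInf.starLE_apply (hsup.1 d hd) q
    have h1 := LInf.starLE_apply hzx p
    rw [LInf.add_apply, LInf.single_self, add_sub_cancel, starLE_iff_le] at h1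
    rw [starLE_complex_iff]
    exact (inner_apply_le_of_le h1 e).trans (hz ⟨_, hne.some_mem⟩).2

theorem isNormalState_vectorFunctional (p : Y.At) {e : Y.space p} (he : ‖e‖ = 1) :
    IsNormalState (vectorFunctional p e) where
  nonneg a := by
    rw [vectorFunctional_apply, LInf.mul_apply, LInf.star_apply, mul_apply_eq_comp,
      ContinuousLinearMap.star_eq_adjoint, ContinuousLinearMap.adjoint_inner_right]
    exact (ContinuousLinearMap.isPositive_one (𝕜 := ℂ)).inner_nonneg_right (a p e)
  map_one := by
    rw [vectorFunctional_apply, LInf.one_apply, one_apply_eq_self, inner_self_eq_norm_sq_to_K, he]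
    simp
  normal := isNormalMap_vectorFunctional p e

/-- Multiplicativity of ε makes the variance vanish: ‖Ψ(a)e - ε(a)e‖² = ε(a*a) - |ε(a)|² = 0. -/
theorem apply_eq_smul_of_vectorFunctional_eq {Ψ : LInf X → LInf Y}
    (hstar : ∀ a, Ψ (star a) = star (Ψ a)) (hmul : ∀ a b, Ψ (a * b) = Ψ a * Ψ b)
    {ε : LInf X →⋆ₐ[ℂ] ℂ} {p : Y.At} {e : Y.space p} (he : ‖e‖ = 1)
    (h : ∀ a, vectorFunctional p e (Ψ a) = ε a) (a : LInf X) : Ψ a p e = ε a • e := by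
  have h1 : ⟪e, Ψ a p e⟫_ℂ = ε a := h a
  have h2 : ⟪Ψ a p e, e⟫_ℂ = starRingEnd ℂ (ε a) := by rw [← inner_conj_symm, h1]
  have h3 : ⟪Ψ a p e, Ψ a p e⟫_ℂ = starRingEnd ℂ (ε a) * ε a := by
    have h4 := h (star a * a)
    rw [hmul, hstar, vectorFunctional_apply, LInf.mul_apply, LInf.star_apply, mul_apply_eq_comp,
      ContinuousLinearMap.star_eq_adjoint, ContinuousLinearMap.adjoint_inner_right, map_mul,
      map_star] at h4
    exact h4
  have h5 : ⟪e, e⟫_ℂ = 1 := by rw [inner_self_eq_norm_sq_to_K, he]; simp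
  rw [← sub_eq_zero, ← inner_self_eq_zero (𝕜 := ℂ), inner_sub_left, inner_sub_right,
    inner_sub_right, inner_smul_left, inner_smul_right, inner_smul_right, inner_smul_left, h1, h2,
    h3, h5]
  ring

/-- If the normal states in a class that contains the vector states of the `g p` restrict to the
character `ε` along `Ψ`, then the `g p` are eigenfunctionals. -/
theorem isEigenfunctional_of_forall_state {Ψ : LInf X → LInf Y}
    (hstar : ∀ a, Ψ (star a) = star (Ψ a)) (hmul : ∀ a b, Ψ (a * b) = Ψ a * Ψ b)
    {ε : LInf X →⋆ₐ[ℂ] ℂ} {g : ∀ p, Y.space p →ₗ[ℂ] ℂ}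
    (h : ∀ φ : LInf Y →ₗ[ℂ] ℂ, IsNormalState φ →
      (∀ z : LInf Y, (∀ p w, g p (z p w) = 0) → φ z = 0) → ∀ a, φ (Ψ a) = ε a) :
    IsEigenfunctional Ψ ε g := by
  rw [isEigenfunctional_iff hstar]
  intro a p
  by_cases hp : g p = 0
  · have h0 : rieszVector (g p) = 0 := by
      rw [rieszVector, hp, map_zero, map_zero]
    rw [h0, map_zero, smul_zero]
  · have ht := rieszVector_ne_zero hp
    set t := rieszVector (g p) with htdef
    have hn : (‖t‖ : ℂ) ≠ 0 := by exact_mod_cast norm_ne_zero_iff.mpr ht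
    have he : ‖((‖t‖ : ℂ)⁻¹ • t)‖ = 1 := by
      rw [norm_smul, norm_inv, Complex.norm_real, norm_norm, inv_mul_cancel₀]
      exact norm_ne_zero_iff.mpr ht
    have h1 := apply_eq_smul_of_vectorFunctional_eq hstar hmul he
      (h _ (isNormalState_vectorFunctional p he) fun z hz => by
        rw [vectorFunctional_apply, inner_smul_left, htdef, inner_rieszVector, hz, mul_zero]) a
    rw [map_smul, smul_comm] at h1
    exact smul_right_injective _ (inv_ne_zero hn) h1

end normal

/-- The kernel of a bilinear form on a tensor product is spanned by elementary tensors. -/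
theorem mem_of_lift_eq_zero {E F : Type*} [AddCommGroup E] [Module ℂ E] [AddCommGroup F]
    [Module ℂ F] {β : E →ₗ[ℂ] F →ₗ[ℂ] ℂ} {S : Submodule ℂ (E ⊗[ℂ] F)}
    (hS : ∀ f x, β f x = 0 → f ⊗ₜ[ℂ] x ∈ S) {w : E ⊗[ℂ] F}
    (hw : TensorProduct.lift β w = 0) : w ∈ S := by
  by_cases hβ : ∃ f x, β f x = 1
  · obtain ⟨f₀, x₀, h0⟩ := hβ
    -- Modulo `S`, every tensor is a multiple of f₀ ⊗ x₀, the factor being its value under β.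
    have key : ∀ w, w - TensorProduct.lift β w • (f₀ ⊗ₜ[ℂ] x₀) ∈ S := by
      intro w
      induction w with
      | zero => simp
      | add w w' hw hw' =>
        rw [map_add, add_smul, add_sub_add_comm]
        exact S.add_mem hw hw'
      | tmul f x =>
        have h1 : ∀ f, f ⊗ₜ[ℂ] x₀ - β f x₀ • (f₀ ⊗ₜ[ℂ] x₀) ∈ S := fun f => by
          rw [TensorProduct.smul_tmul', ← TensorProduct.sub_tmul]
          exact hS _ _ (by simp [h0])
        have h2 : ∀ x, f₀ ⊗ₜ[ℂ] x - β f₀ x • (f₀ ⊗ₜ[ℂ] x₀) ∈ S := fun x => by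
          rw [← TensorProduct.tmul_smul, ← TensorProduct.tmul_sub]
          exact hS _ _ (by simp [h0])
        have h3 : ∀ f x, β f x₀ = 0 → β f₀ x = 0 →
            f ⊗ₜ[ℂ] x - β f x • (f₀ ⊗ₜ[ℂ] x₀) ∈ S := fun f x hf hx => by
          -- The terms β f x and -β f x · β f₀ x₀ cancel, and the cross terms vanish by `hf` and
          -- `hx`.
          have h4 : (f + f₀) ⊗ₜ[ℂ] (x - β f x • x₀) ∈ S := hS _ _ (by simp [h0, hf, hx])
          have h5 : f ⊗ₜ[ℂ] x₀ ∈ S := hS _ _ hf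
          have h6 : f₀ ⊗ₜ[ℂ] x ∈ S := hS _ _ hx
          have h7 : f ⊗ₜ[ℂ] x - β f x • (f₀ ⊗ₜ[ℂ] x₀) =
              (f + f₀) ⊗ₜ[ℂ] (x - β f x • x₀) + β f x • (f ⊗ₜ[ℂ] x₀) - f₀ ⊗ₜ[ℂ] x := by
            rw [TensorProduct.add_tmul, TensorProduct.tmul_sub, TensorProduct.tmul_sub,
              TensorProduct.tmul_smul, TensorProduct.tmul_smul]
            abel
          rw [h7]
          exact S.sub_mem (S.add_mem h4 (S.smul_mem _ h5)) h6
        -- Subtracting the components along f₀ and x₀ reduces to the case `h3`.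
        have h8 := h3 (f - β f x₀ • f₀) (x - β f₀ x • x₀) (by simp [h0]) (by simp [h0])
        have h9 : f ⊗ₜ[ℂ] x - TensorProduct.lift β (f ⊗ₜ[ℂ] x) • (f₀ ⊗ₜ[ℂ] x₀) =
            ((f - β f x₀ • f₀) ⊗ₜ[ℂ] (x - β f₀ x • x₀) -
              β (f - β f x₀ • f₀) (x - β f₀ x • x₀) • (f₀ ⊗ₜ[ℂ] x₀)) +
            β f₀ x • (f ⊗ₜ[ℂ] x₀ - β f x₀ • (f₀ ⊗ₜ[ℂ] x₀)) +
            β f x₀ • (f₀ ⊗ₜ[ℂ] x - β f₀ x • (f₀ ⊗ₜ[ℂ] x₀)) := by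
          simp only [TensorProduct.sub_tmul, TensorProduct.tmul_sub, TensorProduct.tmul_smul,
            ← TensorProduct.smul_tmul', map_sub, map_smul, LinearMap.sub_apply,
            LinearMap.smul_apply, h0, smul_eq_mul, TensorProduct.lift.tmul]
          module
        rw [h9]
        exact S.add_mem (S.add_mem h8 (S.smul_mem _ (h1 f))) (S.smul_mem _ (h2 x))
    have := key w
    rwa [hw, zero_smul, sub_zero] at this
  · have h0 : ∀ f x, β f x = 0 := by
      intro f x
      by_contra h
      exact hβ ⟨(β f x)⁻¹ • f, x, by simp [h]⟩
    clear hw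
    induction w with
    | zero => exact S.zero_mem
    | tmul f x => exact hS _ _ (h0 f x)
    | add w w' hw hw' => exact S.add_mem hw hw'

/-! ### Separating projections and diagonal states -/

section

variable {X : QuantumSet.{u, v}} {Y : QuantumSet.{u', v'}}

theorem LInf.isStarProjection_tmul {a : LInf X} {b : LInf Y} (ha : IsStarProjection a)
    (hb : IsStarProjection b) : IsStarProjection (LInf.tmul a b) := by
  refine LInf.isStarProjection_of_apply fun p => ⟨?_, ?_⟩
  · refine (TensorProduct.mapL_mul (a p.1) (a p.1) (b p.2) (b p.2)).symm.trans ?_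
    exact congrArg₂ TensorProduct.mapL
      (congrArg (fun z : LInf X => z p.1) ha.isIdempotentElem.eq)
      (congrArg (fun z : LInf Y => z p.2) hb.isIdempotentElem.eq)
  · refine (TensorProduct.adjoint_mapL (a p.1) (b p.2)).trans ?_
    exact congrArg₂ TensorProduct.mapL
      (congrArg (fun z : LInf X => z p.1) ha.isSelfAdjoint.star_eq)
      (congrArg (fun z : LInf Y => z p.2) hb.isSelfAdjoint.star_eq)

theorem isStarProjection_opIso {q : LInf X} (hq : IsStarProjection q) :
    IsStarProjection (opIso X (MulOpposite.op q)) := by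
  refine ⟨?_, ?_⟩
  · rw [IsIdempotentElem, ← map_mul, ← MulOpposite.op_mul, hq.isIdempotentElem.eq]
  · rw [IsSelfAdjoint, ← map_star, ← MulOpposite.op_star, hq.isSelfAdjoint.star_eq]

namespace QRel

theorem pairing_self (i : X.At) (f : StrongDual ℂ (X.space i)) (x : X.space i) :
    pairing X i i f x = f x := by
  rw [pairing, dif_pos rfl]
  rfl

theorem pairing_ne {i j : X.At} (h : i ≠ j) : pairing X i j = 0 := by
  rw [pairing, dif_neg h]

theorem pairing_comp {a b : LInf X} (h : a * b = 0) (i j : X.At)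
    (f : StrongDual ℂ (X.space i)) (x : X.space j) : pairing X i j (f ∘L a i) (b j x) = 0 := by
  by_cases hij : i = j
  · subst hij
    rw [pairing_self]
    have : a i * b i = 0 := congrArg (fun z : LInf X => z i) h
    rw [ContinuousLinearMap.comp_apply, ← mul_apply_eq_comp, this, zero_apply, map_zero]
  · rw [pairing_ne hij]
    rfl

/-- A functional and a vector that pair to zero are separated by a projection. -/
theorem exists_projection {i j : X.At} {f : StrongDual ℂ (X.space i)} {x : X.space j}
    (h : pairing X i j f x = 0) :
    ∃ q : LInf X, IsStarProjection q ∧ f ∘L q i = f ∧ q j x = 0 := by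
  by_cases hij : i = j
  · subst hij
    rw [pairing_self] at h
    let e := (InnerProductSpace.toDual ℂ (X.space i)).symm f
    -- The projection onto the line of the Riesz vector of `f` fixes `f` and kills `x`, which is
    -- orthogonal to that line.
    refine ⟨LInf.single i (ℂ ∙ e).starProjection,
      LInf.isStarProjection_single isStarProjection_starProjection, ?_, ?_⟩
    · apply (InnerProductSpace.toDual ℂ (X.space i)).symm.injective
      rw [LInf.single_self, toDual_symm_precomp, ← ContinuousLinearMap.star_eq_adjoint,
        (isStarProjection_starProjection (U := (ℂ ∙ e))).isSelfAdjoint.star_eq]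
      exact Submodule.starProjection_eq_self_iff.mpr (Submodule.mem_span_singleton_self e)
    · rw [LInf.single_self, Submodule.starProjection_apply_eq_zero_iff,
        Submodule.mem_orthogonal_singleton_iff_inner_right]
      exact InnerProductSpace.toDual_symm_apply.trans h
  · refine ⟨LInf.single i 1, LInf.isStarProjection_single (.one _), ?_, ?_⟩
    · rw [LInf.single_self]
      rfl
    · rw [LInf.single_ne (Ne.symm hij), zero_apply]

end QRel

end

section states

variable {X : QuantumSet.{u, v}} {Y : QuantumSet.{u', v'}}

/-- The vectors `w` such that `φ` vanishes on all operators of rank one with range in `ℂ w`. -/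
def rankOneKernel (φ : LInf Y →ₗ[ℂ] ℂ) (p : Y.At) : Submodule ℂ (Y.space p) where
  carrier := {w | ∀ x, φ (LInf.single p (InnerProductSpace.rankOne ℂ w x)) = 0}
  zero_mem' x := by
    have h : LInf.single p (0 : Y.space p →L[ℂ] Y.space p) = 0 :=
      LInf.ext_single (j := p) (by simp) fun i hi => by simp [LInf.single_ne hi]
    rw [map_zero, zero_apply, h, map_zero]
  add_mem' hw hw' x := by rw [map_add, add_apply, LInf.single_add, map_add, hw, hw', add_zero]
  smul_mem' c w hw x := by
    rw [map_smul, smul_apply, LInf.single_smul, map_smul, hw, smul_zero]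

/-- Here |w⟩⟨x| = z|w⟩⟨x|, and a state vanishing on a projection vanishes on its right multiples. -/
theorem mem_rankOneKernel {φ : LInf Y →ₗ[ℂ] ℂ} (hφ : IsNormalState φ) {p : Y.At} {z : LInf Y}
    (hz : IsStarProjection z) (h0 : φ z = 0) {w : Y.space p} (hw : z p w = w) :
    w ∈ rankOneKernel φ p := by
  intro x
  rw [← hw, ← InnerProductSpace.comp_rankOne, ← ContinuousLinearMap.mul_def, ← LInf.mul_single]
  exact map_mul_eq_zero_of_isStarProjection hφ.nonneg hz h0 _

theorem IsOpDiagonalState.mem_rankOneKernel_of_evFun {φ : LInf (X.dual.prod X) →ₗ[ℂ] ℂ}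
    (hφ : IsOpDiagonalState φ) (p : (X.dual.prod X).At) (w : (X.dual.prod X).space p)
    (hw : QRel.evFun X p w = 0) : w ∈ rankOneKernel φ p := by
  refine mem_of_lift_eq_zero (β := QRel.pairing X (QuantumSet.predual p.1) p.2)
    (S := rankOneKernel φ p) (fun f x h => ?_) hw
  obtain ⟨q, hq, hf, hx⟩ := QRel.exists_projection h
  refine mem_rankOneKernel hφ.toIsNormalState
    (LInf.isStarProjection_tmul (isStarProjection_opIso hq) hq.one_sub) (hφ.diagonal q hq) ?_
  refine (TensorProduct.mapL_tmul _ _ _ _).trans (congrArg₂ (fun f x => f ⊗ₜ[ℂ] x) hf ?_)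
  rw [LInf.sub_apply, sub_apply, hx, sub_zero]
  rfl

theorem IsDiagonalState.mem_rankOneKernel_of_evDualFun {φ : LInf (X.prod X.dual) →ₗ[ℂ] ℂ}
    (hφ : IsDiagonalState φ) (p : (X.prod X.dual).At) (w : (X.prod X.dual).space p)
    (hw : QRel.evDualFun X p w = 0) : w ∈ rankOneKernel φ p := by
  refine mem_of_lift_eq_zero (β := (QRel.pairing X (QuantumSet.predual p.2) p.1).flip)
    (S := rankOneKernel φ p) (fun x f h => ?_) hw
  obtain ⟨q, hq, hf, hx⟩ := QRel.exists_projection h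
  -- The diagonal condition is used for 1 - q, so that `q` acts on the functional and 1 - q on the
  -- vector.
  refine mem_rankOneKernel hφ.toIsNormalState
    (LInf.isStarProjection_tmul hq.one_sub (isStarProjection_opIso hq.one_sub.one_sub))
    (hφ.diagonal (1 - q) hq.one_sub) ?_
  refine (TensorProduct.mapL_tmul _ _ _ _).trans (congrArg₂ (fun x f => x ⊗ₜ[ℂ] f) ?_ ?_)
  · rw [LInf.sub_apply, sub_apply, hx, sub_zero]
    rfl
  · rw [sub_sub_cancel]
    exact hf

/-- With a = q and b = 1 - q this makes the vector states of the evaluation diagonal. -/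
theorem evFun_tmul_apply {a b : LInf X} (h : a * b = 0) (p : (X.dual.prod X).At)
    (w : (X.dual.prod X).space p) :
    QRel.evFun X p (LInf.tmul (opIso X (MulOpposite.op a)) b p w) = 0 := by
  have h0 : (TensorProduct.lift (QRel.pairing X (QuantumSet.predual p.1) p.2)) ∘ₗ
      (TensorProduct.mapL (opIso X (MulOpposite.op a) p.1) (b p.2)).toLinearMap = 0 :=
    TensorProduct.ext' fun f x => QRel.pairing_comp h _ _ f x
  exact LinearMap.congr_fun h0 w

theorem evDualFun_tmul_apply {a b : LInf X} (h : a * b = 0) (p : (X.prod X.dual).At)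
    (w : (X.prod X.dual).space p) :
    QRel.evDualFun X p (LInf.tmul b (opIso X (MulOpposite.op a)) p w) = 0 := by
  have h0 : (TensorProduct.lift (QRel.pairing X (QuantumSet.predual p.2) p.1).flip) ∘ₗ
      (TensorProduct.mapL (b p.1) (opIso X (MulOpposite.op a) p.2)).toLinearMap = 0 :=
    TensorProduct.ext' fun x f => QRel.pairing_comp h _ _ f x
  exact LinearMap.congr_fun h0 w

end states

/-! ### The diagonal conditions as eigenvalue equations, and the theorem -/

namespace DiscreteQuantumMonoid

variable {X : QuantumSet.{u, v}}

theorem leftDiagonalCondition_iff (M : DiscreteQuantumMonoid X)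
    (s : WStarHom (LInf X) (LInf X)ᵐᵒᵖ) : M.LeftDiagonalCondition s ↔
    IsEigenfunctional (tensorHom (toDualHom s) (StarAlgHom.id ℂ (LInf X)) ∘ M.comul.toStarAlgHom)
      M.counit.toStarAlgHom (QRel.evFun X) := by
  constructor
  · intro h
    refine isEigenfunctional_of_forall_state (fun a => ?_) (fun a b => ?_) fun φ hφ hz a => ?_
    · simp only [Function.comp_apply, map_star]
    · simp only [Function.comp_apply, map_mul]
    · refine h φ ⟨hφ, fun q hq => hz _ fun p w => evFun_tmul_apply ?_ p w⟩ a
      rw [mul_sub, mul_one, hq.isIdempotentElem.eq, sub_self]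
  · intro h φ hφ a
    exact hφ.toIsNormalState.apply_eq_of_isEigenfunctional hφ.mem_rankOneKernel_of_evFun h a

theorem rightDiagonalCondition_iff (M : DiscreteQuantumMonoid X)
    (s : WStarHom (LInf X) (LInf X)ᵐᵒᵖ) : M.RightDiagonalCondition s ↔
    IsEigenfunctional (tensorHom (StarAlgHom.id ℂ (LInf X)) (toDualHom s) ∘ M.comul.toStarAlgHom)
      M.counit.toStarAlgHom (QRel.evDualFun X) := by
  constructor
  · intro h
    refine isEigenfunctional_of_forall_state (fun a => ?_) (fun a b => ?_) fun φ hφ hz a => ?_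
    · simp only [Function.comp_apply, map_star]
    · simp only [Function.comp_apply, map_mul]
    · refine h φ ⟨hφ, fun q hq => hz _ fun p w => evDualFun_tmul_apply ?_ p w⟩ a
      rw [sub_mul, one_mul, hq.isIdempotentElem.eq, sub_self]
  · intro h φ hφ a
    exact hφ.toIsNormalState.apply_eq_of_isEigenfunctional hφ.mem_rankOneKernel_of_evDualFun h a

/-- Without atoms 1 = 0 in M, which the unital map ε excludes. An atom is needed for a nonzero
evaluation. -/
theorem nonempty_atoms (M : DiscreteQuantumMonoid X) : Nonempty X.At := by
  by_contra h
  rw [not_nonempty_iff] at h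
  have h0 : (1 : LInf X) = 0 := LInf.ext fun i => h.elim i
  have h1 := congrArg M.counit.toStarAlgHom h0
  rw [map_one, map_zero] at h1
  exact one_ne_zero h1

theorem exists_evFun_ne_zero (M : DiscreteQuantumMonoid X) : ∃ p, QRel.evFun X p ≠ 0 := by
  obtain ⟨i⟩ := M.nonempty_atoms
  obtain ⟨x, hx⟩ := exists_ne (0 : X.space i)
  let p : (X.dual.prod X).At := (i, i)
  refine ⟨p, fun h => hx ?_⟩
  have h1 : QRel.pairing X i i (InnerProductSpace.toDual ℂ (X.space i) x) x = 0 :=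
    LinearMap.congr_fun h ((InnerProductSpace.toDual ℂ (X.space i) x) ⊗ₜ[ℂ] x)
  rw [QRel.pairing_self, InnerProductSpace.toDual_apply_apply] at h1
  exact inner_self_eq_zero.mp h1

theorem exists_evDualFun_ne_zero (M : DiscreteQuantumMonoid X) : ∃ p, QRel.evDualFun X p ≠ 0 := by
  obtain ⟨i⟩ := M.nonempty_atoms
  obtain ⟨x, hx⟩ := exists_ne (0 : X.space i)
  let p : (X.prod X.dual).At := (i, i)
  refine ⟨p, fun h => hx ?_⟩
  have h1 : QRel.pairing X i i (InnerProductSpace.toDual ℂ (X.space i) x) x = 0 :=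
    LinearMap.congr_fun h (x ⊗ₜ[ℂ] (InnerProductSpace.toDual ℂ (X.space i) x))
  rw [QRel.pairing_self, InnerProductSpace.toDual_apply_apply] at h1
  exact inner_self_eq_zero.mp h1

end DiscreteQuantumMonoid

theorem QRel.isEigenfunctional_iff_relations {X : QuantumSet.{u, v}} {Y : QuantumSet.{u', v'}}
    {Ψ : LInf X → LInf Y} {ε : LInf X →⋆ₐ[ℂ] ℂ} {g : ∀ p, Y.space p →ₗ[ℂ] ℂ} {R : QRel Y X}
    (hΨ : ∀ a, Ψ (star a) = star (Ψ a)) (hR : R.Intertwines Ψ) (hs : R.Separating)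
    (hg : ∃ p, g p ≠ 0) :
    (IsEigenfunctional Ψ ε g ↔ ofFunctional g ≤ (hat (scalarIso.comp ε)).dagger.comp R) ∧
      (IsEigenfunctional Ψ ε g ↔ R.comp (ofFunctional g).dagger = hat (scalarIso.comp ε)) :=
  ⟨⟨ofFunctional_le_of_isEigenfunctional hΨ hR hs, isEigenfunctional_of_ofFunctional_le hR⟩,
    ⟨comp_dagger_eq_of_isEigenfunctional hΨ hR hs hg,
      isEigenfunctional_of_comp_dagger_eq hΨ hR hs⟩⟩

end

theorem mainTheorem4 (X : QuantumSet.{u, v}) (M : DiscreteQuantumMonoid X)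
    (s : WStarHom (LInf X) (LInf X)ᵐᵒᵖ) :
    ((M.LeftDiagonalCondition s ↔
        QRel.ev X ≤ QRel.comp (QRel.dagger M.counitRel)
          (QRel.comp M.comulRel (QRel.prod (antipodeRel s) (QRel.id X)))) ∧
      (M.RightDiagonalCondition s ↔
        QRel.evDual X ≤ QRel.comp (QRel.dagger M.counitRel)
          (QRel.comp M.comulRel (QRel.prod (QRel.id X) (antipodeRel s))))) ∧
    ((M.LeftDiagonalCondition s ↔
        QRel.comp M.comulRel
          (QRel.comp (QRel.prod (antipodeRel s) (QRel.id X)) (QRel.dagger (QRel.ev X))) =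
            M.counitRel) ∧
      (M.RightDiagonalCondition s ↔
        QRel.comp M.comulRel
          (QRel.comp (QRel.prod (QRel.id X) (antipodeRel s)) (QRel.dagger (QRel.evDual X))) =
            M.counitRel)) := by
  have hl := QRel.isEigenfunctional_iff_relations (ε := M.counit.toStarAlgHom)
    (Ψ := tensorHom (toDualHom s) (StarAlgHom.id ℂ (LInf X)) ∘ M.comul.toStarAlgHom)
    (fun a => by simp only [Function.comp_apply, map_star])
    ((QRel.hat_intertwines M.comul.toStarAlgHom).comp
      ((QRel.hat_intertwines (toDualHom s)).prod QRel.id_intertwines))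
    ((QRel.hat_separating M.comul.nondegenerate).comp
      ((QRel.hat_separating (toDualHom_nondegenerate s)).prod QRel.id_separating))
    M.exists_evFun_ne_zero
  have hr := QRel.isEigenfunctional_iff_relations (ε := M.counit.toStarAlgHom)
    (Ψ := tensorHom (StarAlgHom.id ℂ (LInf X)) (toDualHom s) ∘ M.comul.toStarAlgHom)
    (fun a => by simp only [Function.comp_apply, map_star])
    ((QRel.hat_intertwines M.comul.toStarAlgHom).comp
      (QRel.id_intertwines.prod (QRel.hat_intertwines (toDualHom s))))
    ((QRel.hat_separating M.comul.nondegenerate).comp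
      (QRel.id_separating.prod (QRel.hat_separating (toDualHom_nondegenerate s))))
    M.exists_evDualFun_ne_zero
  rw [M.leftDiagonalCondition_iff, M.rightDiagonalCondition_iff]
  -- The evaluations are `ofFunctional` of their functionals by definition; only the equalities need
  -- to be reassociated.
  refine ⟨⟨hl.1, hr.1⟩, ?_, ?_⟩
  · rw [← QRel.comp_assoc]
    exact hl.2
  · rw [← QRel.comp_assoc]
    exact hr.2
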